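/- For an integrable function $g\colon\mathbb{R}\to\mathbb{C}$ of compact support and $\xi\in\mathbb{R}$, let $a(\cdot,\xi)$, $b(\cdot,\xi)$ be the (locally) absolutely continuous solution of the initial value problem $$\partial_x a(x,\xi)=\overline{g(x)}\,e^{2\pi i x\xi}\,b(x,\xi),\qquad \partial_x b(x,\xi)=g(x)\,e^{-2\pi i x\xi}\,a(x,\xi)\quad\text{for a.e. }x\in\mathbb{R},$$ $$a(-\infty,\xi)=1,\qquad b(-\infty,\xi)=0,$$ and call $\xi\mapsto(a(+\infty,\xi),b(+\infty,\xi))$ the nonlinear Fourier transform of $g$. For a general $f\in L^1(\mathbb{R})$ let $(a_R,b_R)$ be the nonlinear Fourier transform of $f\mathbf{1}_{[-R,R]}$, $R>0$, and define the nonlinear Fourier transform $(a,b)$ of $f$ by $a(\xi)=\lim_{R\to\infty}a_R(\xi)$, $b(\xi)=\lim_{R\to\infty}b_R(\xi)$. Let $1<p<2$, $q=\frac{p}{p-1}$ and $\mathbf{B}_p=p^{\frac1{2p}}q^{-\frac1{2q}}$. Then for every $f\in L^1(\mathbb{R})$ the nonlinear Fourier transform $(a,b)$ exists and is uniquely determined,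 $|a(\xi)|\ge 1$ for every $\xi\in\mathbb{R}$, the function $\xi\mapsto(\log|a(\xi)|^2)^{1/2}$ is measurable, and $$\big\|(\log|a(\xi)|^2)^{1/2}\big\|_{L^q_\xi(\mathbb{R})}\le \mathbf{B}_p\,\exp\big(\|f\|_{L^1(\mathbb{R})}\big)\,\|f\|_{L^p(\mathbb{R})},$$ where the right-hand side is $+\infty$ if $f\notin L^p(\mathbb{R})$. -/

import Mathlib

open MeasureTheory Filter Topology

/-- `A`, `B` are (locally) absolutely continuous functions on the real line that solve, for the
potential `f` and the spectral parameter `ξ`, the initial value problem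
`A' = conj f(x) e^{2πixξ} B`, `B' = f(x) e^{-2πixξ} A` a.e., `A(-∞) = 1`, `B(-∞) = 0`. -/
structure IsScatteringSolution (f : ℝ → ℂ) (ξ : ℝ) (A B : ℝ → ℂ) : Prop where
  absCont_fst : ∀ α β : ℝ, AbsolutelyContinuousOnInterval A α β
  absCont_snd : ∀ α β : ℝ, AbsolutelyContinuousOnInterval B α β
  ode_fst : ∀ᵐ x : ℝ, HasDerivAt A
    (starRingEnd ℂ (f x) * Complex.exp (2 * Real.pi * Complex.I * x * ξ) * B x) x
  ode_snd : ∀ᵐ x : ℝ, HasDerivAt B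
    (f x * Complex.exp (-(2 * Real.pi * Complex.I * x * ξ)) * A x) x
  init_fst : Tendsto A atBot (𝓝 1)
  init_snd : Tendsto B atBot (𝓝 0)

/-- `(a, b)` is the nonlinear Fourier transform of the compactly supported integrable
function `g`: for each `ξ`, `a ξ` and `b ξ` are the limits at `+∞` of the solution of the
initial value problem. -/
def IsNLFTCompact (g a b : ℝ → ℂ) : Prop :=
  ∀ ξ : ℝ, ∃ A B : ℝ → ℂ, IsScatteringSolution g ξ A B ∧
    Tendsto A atTop (𝓝 (a ξ)) ∧ Tendsto B atTop (𝓝 (b ξ))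

/-- `(a, b)` is the nonlinear Fourier transform of the integrable function `f`: the pointwise
limit, as `R → ∞`, of the nonlinear Fourier transforms of the truncations of `f` to `[-R, R]`. -/
def IsNLFT (f a b : ℝ → ℂ) : Prop :=
  ∃ aR bR : ℝ → ℝ → ℂ,
    (∀ R : ℝ, 0 < R → IsNLFTCompact ((Set.Icc (-R) R).indicator f) (aR R) (bR R)) ∧
    ∀ ξ : ℝ, Tendsto (fun R : ℝ => aR R ξ) atTop (𝓝 (a ξ)) ∧
      Tendsto (fun R : ℝ => bR R ξ) atTop (𝓝 (b ξ))

/-- The Babenko–Beckner constant `p^{1/(2p)} q^{-1/(2q)}`, where `q = p / (p - 1)`. -/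
noncomputable def becknerConst (p : ℝ) : ℝ :=
  p ^ (1 / (2 * p)) * (p / (p - 1)) ^ (-(1 / (2 * (p / (p - 1)))))

/-! Nonlinear part. The system conserves `|a|² - |b|² = 1`, so `log |a|² = log (1 + |b|²) ≤ |b|²`,
and it suffices to bound `b` in `L^q` (`eLpNorm_scatterData_snd_le`). Integrate the equation for `b`
and insert `a(y) = 1 + ∫_{t ≤ y} a'(t) dt`. After Fubini, `b` is the linear Fourier transform of `f`
plus the superposition, with weight `a'(t)`, of the linear Fourier transforms of `f · 1_{[t,∞)}`
(`scatterData_snd_eq`). The sharp linear Hausdorff–Young inequality bounds every one of these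
transforms by the same number `B_p ‖f‖_p`. By Grönwall `|a'(t)| ≤ |f(t)| exp (∫_{-∞}^t |f|)`, and
this majorant has total mass exactly `e^{‖f‖₁} - 1`. Minkowski then gives the constant `1 +
(e^{‖f‖₁} - 1) = e^{‖f‖₁}`.

Existence comes from a contraction in a weighted sup norm on functions of `(x, ξ)`, which also
yields joint continuity (`exists_scattering_family`). Uniqueness is algebra: two bilinear
expressions in a pair of solutions are constant. The limit over truncations exists because the data
depend continuously on the potential in `L¹` (`norm_scatterData_sub_le`).

Linear part. The sharp Hausdorff–Young inequality is proved by Beckner's method. A two-point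
inequality for the map `a + b ε ↦ a + i√(p-1) b ε` (`complex_two_point`) tensorises to the cube by
Minkowski (`complex_hypercube`). The central limit theorem turns it into an `L^p → L^q` bound with
respect to the Gaussian measure for the Mehler operator with imaginary parameter `i√(p-1)`, applied
to trigonometric polynomials (`gaussian_complex_hypercontractivity`). Multiplying by `exp
(-x²/(2p))` and dilating converts this operator into the Fourier transform on the line, and the
normalising factors combine to `B_p`. Density arguments then reach all integrable functions
(`sharpHausdorffYoung`). -/

/-! ### Real two-point hypercontractivity. -/

theorem two_mul_mul_le_rpow_sub_rpow {s x : ℝ} (hs0 : 0 < s) (hs1 : s < 1) (hx0 : 0 ≤ x)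
    (hx1 : x ≤ 1) : 2 * s * x ≤ (1 + x) ^ s - (1 - x) ^ s := by
  have hmono : MonotoneOn (fun x : ℝ => (1 + x) ^ s - (1 - x) ^ s - 2 * s * x) (Set.Icc 0 1) := by
    have hd : ∀ x ∈ Set.Ioo (0 : ℝ) 1, HasDerivAt
        (fun x : ℝ => (1 + x) ^ s - (1 - x) ^ s - 2 * s * x)
        (s * (1 + x) ^ (s - 1) + s * (1 - x) ^ (s - 1) - 2 * s) x := by
      intro x hx
      have h1 : HasDerivAt (fun x : ℝ => (1 + x) ^ s) (1 * s * (1 + x) ^ (s - 1)) x :=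
        ((hasDerivAt_id x).const_add 1).rpow_const (Or.inl (by simp; linarith [hx.1]))
      have h2 : HasDerivAt (fun x : ℝ => (1 - x) ^ s) (-1 * s * (1 - x) ^ (s - 1)) x :=
        ((hasDerivAt_id x).const_sub 1).rpow_const (Or.inl (by simp; linarith [hx.2]))
      have h3 : HasDerivAt (fun x : ℝ => 2 * s * x) (2 * s * 1) x :=
        (hasDerivAt_id x).const_mul (2 * s)
      exact ((h1.sub h2).sub h3).congr_deriv (by ring)
    refine monotoneOn_of_deriv_nonneg (convex_Icc 0 1) ?_ ?_ ?_
    · refine ContinuousOn.sub (ContinuousOn.sub ?_ ?_) (by fun_prop)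
      · exact ContinuousOn.rpow_const (by fun_prop) (fun x _ => Or.inr hs0.le)
      · exact ContinuousOn.rpow_const (by fun_prop) (fun x _ => Or.inr hs0.le)
    · rw [interior_Icc]
      exact fun x hx => (hd x hx).differentiableAt.differentiableWithinAt
    · rw [interior_Icc]
      intro x hx
      rw [(hd x hx).deriv]
      have hp : 0 < 1 + x := by linarith [hx.1]
      have hm : 0 < 1 - x := by linarith [hx.2]
      set A := (1 + x) ^ (s - 1)
      set B := (1 - x) ^ (s - 1)
      have hA : 0 < A := Real.rpow_pos_of_pos hp _
      have hB : 0 < B := Real.rpow_pos_of_pos hm _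
      -- The derivative is `s (A + B - 2)`. Since `A B = (1 - x²)^(s-1) ≥ 1`, the
      -- arithmetic–geometric mean inequality gives `A + B ≥ 2`.
      have hAB : 1 ≤ A * B := by
        rw [← Real.mul_rpow hp.le hm.le]
        exact Real.one_le_rpow_of_pos_of_le_one_of_nonpos (by positivity)
          (by nlinarith [hx.1]) (by linarith)
      have : 2 ≤ A + B := by nlinarith [sq_nonneg (A - B)]
      nlinarith
  have h := hmono (Set.left_mem_Icc.2 zero_le_one) ⟨hx0, hx1⟩ hx0
  simp at h
  linarith

/-- Equality holds at `0`, and the derivative of the difference is nonnegative by the preceding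
lemma with `s = p - 1`. -/
theorem two_add_le_rpow_add_rpow {p x : ℝ} (hp1 : 1 < p) (hp2 : p < 2) (hx0 : 0 ≤ x)
    (hx1 : x ≤ 1) : 2 + p * (p - 1) * x ^ 2 ≤ (1 + x) ^ p + (1 - x) ^ p := by
  have hmono : MonotoneOn (fun x : ℝ => (1 + x) ^ p + (1 - x) ^ p - p * (p - 1) * x ^ 2)
      (Set.Icc 0 1) := by
    have hd : ∀ x ∈ Set.Ioo (0 : ℝ) 1, HasDerivAt
        (fun x : ℝ => (1 + x) ^ p + (1 - x) ^ p - p * (p - 1) * x ^ 2)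
        (p * ((1 + x) ^ (p - 1) - (1 - x) ^ (p - 1) - 2 * (p - 1) * x)) x := by
      intro x hx
      have h1 : HasDerivAt (fun x : ℝ => (1 + x) ^ p) (1 * p * (1 + x) ^ (p - 1)) x :=
        ((hasDerivAt_id x).const_add 1).rpow_const (Or.inr hp1.le)
      have h2 : HasDerivAt (fun x : ℝ => (1 - x) ^ p) (-1 * p * (1 - x) ^ (p - 1)) x :=
        ((hasDerivAt_id x).const_sub 1).rpow_const (Or.inr hp1.le)
      have h3 := (hasDerivAt_pow 2 x).const_mul (p * (p - 1))
      exact ((h1.add h2).sub h3).congr_deriv (by push_cast; ring)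
    refine monotoneOn_of_deriv_nonneg (convex_Icc 0 1) ?_ ?_ ?_
    · refine ContinuousOn.sub (ContinuousOn.add ?_ ?_) (by fun_prop)
      · exact ContinuousOn.rpow_const (by fun_prop) (fun x _ => Or.inr (by linarith))
      · exact ContinuousOn.rpow_const (by fun_prop) (fun x _ => Or.inr (by linarith))
    · rw [interior_Icc]
      exact fun x hx => (hd x hx).differentiableAt.differentiableWithinAt
    · rw [interior_Icc]
      intro x hx
      rw [(hd x hx).deriv]
      have := two_mul_mul_le_rpow_sub_rpow (s := p - 1) (by linarith) (by linarith) hx.1.le hx.2.le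
      exact mul_nonneg (by linarith) (by linarith)
  have h := hmono (Set.left_mem_Icc.2 zero_le_one) ⟨hx0, hx1⟩ hx0
  simp at h
  linarith

/-- Two-point hypercontractivity from `L^p` to `L^2`, normalised. -/
theorem one_add_rpow_le_two_point {p x : ℝ} (hp1 : 1 < p) (hp2 : p < 2) :
    (1 + (p - 1) * x ^ 2) ^ (p / 2) ≤ (|1 + x| ^ p + |1 - x| ^ p) / 2 := by
  -- On `[0, 1]`, Bernoulli with exponent `p / 2 ≤ 1` linearises the left side to `1 + p (p - 1) y²
  -- / 2`, which is exactly the lower bound already found for the right side.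
  have key : ∀ y : ℝ, 0 ≤ y → y ≤ 1 →
      (1 + (p - 1) * y ^ 2) ^ (p / 2) ≤ (|1 + y| ^ p + |1 - y| ^ p) / 2 := by
    intro y hy0 hy1
    rw [abs_of_nonneg (by linarith), abs_of_nonneg (by linarith : 0 ≤ 1 - y)]
    have h1 := two_add_le_rpow_add_rpow hp1 hp2 hy0 hy1
    have h2 : (1 + (p - 1) * y ^ 2) ^ (p / 2) ≤ 1 + p / 2 * ((p - 1) * y ^ 2) :=
      rpow_one_add_le_one_add_mul_self (by nlinarith [sq_nonneg y]) (by linarith) (by linarith)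
    nlinarith
  wlog hx : 0 ≤ x generalizing x
  · have := this (x := -x) (by linarith)
    rw [neg_sq, sub_neg_eq_add, ← sub_eq_add_neg] at this
    linarith
  rcases le_total x 1 with h | h
  · exact key x hx h
  · have hx0 : 0 < x := by linarith
    -- For `x ≥ 1` the right side is `x^p` times its value at `x⁻¹`. The left side is handled by `1
    -- + (p - 1) x² ≤ x² + (p - 1)`, which is `(2 - p)(x² - 1) ≥ 0`.
    have h1 := key x⁻¹ (by positivity) (inv_le_one_of_one_le₀ h)
    have h2 : (|1 + x| ^ p + |1 - x| ^ p) / 2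
        = x ^ p * ((|1 + x⁻¹| ^ p + |1 - x⁻¹| ^ p) / 2) := by
      have e1 : |1 + x| = x * |1 + x⁻¹| := by
        nth_rewrite 2 [← abs_of_pos hx0]
        rw [← abs_mul]
        congr 1
        field_simp
        ring
      have e2 : |1 - x| = x * |1 - x⁻¹| := by
        nth_rewrite 2 [← abs_of_pos hx0]
        rw [← abs_mul, ← abs_neg]
        congr 1
        field_simp
        ring
      rw [e1, e2, Real.mul_rpow hx0.le (abs_nonneg _), Real.mul_rpow hx0.le (abs_nonneg _)]
      ring
    rw [h2]
    calc (1 + (p - 1) * x ^ 2) ^ (p / 2)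
        ≤ (x ^ 2 * (1 + (p - 1) * x⁻¹ ^ 2)) ^ (p / 2) := by
          apply Real.rpow_le_rpow (by nlinarith [sq_nonneg x]) _ (by linarith)
          have : x ^ 2 * (1 + (p - 1) * x⁻¹ ^ 2) = x ^ 2 + (p - 1) := by field_simp
          rw [this]
          have : 1 ≤ x ^ 2 := one_le_pow₀ h
          nlinarith
      _ = x ^ p * (1 + (p - 1) * x⁻¹ ^ 2) ^ (p / 2) := by
          rw [Real.mul_rpow (by positivity) (by nlinarith [sq_nonneg x⁻¹]), ← Real.rpow_natCast,
            ← Real.rpow_mul hx0.le]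
          congr 2
          push_cast
          ring
      _ ≤ _ := by gcongr

/-- Two-point hypercontractivity from `L^p` to `L^2`. -/
theorem sq_add_rpow_le_two_point {p a b : ℝ} (hp1 : 1 < p) (hp2 : p < 2) :
    (a ^ 2 + (p - 1) * b ^ 2) ^ (p / 2) ≤ (|a + b| ^ p + |a - b| ^ p) / 2 := by
  rcases eq_or_ne a 0 with rfl | ha
  · have h1 : (0 ^ 2 + (p - 1) * b ^ 2) ^ (p / 2) ≤ (b ^ 2) ^ (p / 2) := by
      apply Real.rpow_le_rpow (by nlinarith [sq_nonneg b]) _ (by linarith)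
      nlinarith [sq_nonneg b]
    have h2 : (b ^ 2) ^ (p / 2) = |b| ^ p := by
      rw [← sq_abs, ← Real.rpow_natCast, ← Real.rpow_mul (abs_nonneg _)]
      congr 1
      push_cast
      ring
    simp only [zero_add, zero_sub, abs_neg]
    linarith
  · have h := one_add_rpow_le_two_point (x := b / a) hp1 hp2
    have e1 : |a + b| = |a| * |1 + b / a| := by rw [← abs_mul]; congr 1; field_simp
    have e2 : |a - b| = |a| * |1 - b / a| := by rw [← abs_mul]; congr 1; field_simp
    have e3 : (a ^ 2 + (p - 1) * b ^ 2) ^ (p / 2)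
        = |a| ^ p * (1 + (p - 1) * (b / a) ^ 2) ^ (p / 2) := by
      have : a ^ 2 + (p - 1) * b ^ 2 = |a| ^ (2 : ℝ) * (1 + (p - 1) * (b / a) ^ 2) := by
        rw [Real.rpow_two, sq_abs]; field_simp
      rw [this, Real.mul_rpow (by positivity) (by nlinarith [sq_nonneg (b / a)]),
        ← Real.rpow_mul (abs_nonneg _)]
      congr 2
      ring
    rw [e1, e2, e3, Real.mul_rpow (abs_nonneg _) (abs_nonneg _),
      Real.mul_rpow (abs_nonneg _) (abs_nonneg _)]
    have := mul_le_mul_of_nonneg_left h (Real.rpow_nonneg (abs_nonneg a) p)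
    linarith

/-- Two-point hypercontractivity from `L^2` to `L^q`. -/
theorem two_point_le_one_add_rpow {p q y : ℝ} (hp1 : 1 < p) (hp2 : p < 2)
    (hq : q = p / (p - 1)) :
    (|1 + y| ^ q + |1 - y| ^ q) / 2 ≤ (1 + (q - 1) * y ^ 2) ^ (q / 2) := by
  have hp0 : 0 < p - 1 := by linarith
  have hq2 : 2 < q := by rw [hq, lt_div_iff₀ hp0]; linarith
  have hpq : (q - 1) * p = q := by rw [hq]; field_simp; ring
  have hq1 : q - 1 = 1 / (p - 1) := by rw [hq]; field_simp; ring
  set N := (|1 + y| ^ q + |1 - y| ^ q) / 2 with hN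
  have hN0 : 0 ≤ N := by positivity
  rcases hN0.eq_or_lt with h0 | hNpos
  · rw [← h0]
    exact Real.rpow_nonneg (by nlinarith [sq_nonneg y]) _
  -- Duality: `u` and `w` are the values of the extremal dual function `F |F|^(q-2)` for `F = 1 ±
  -- y`. Its `p`-th power mean and its pairing with `F` both equal `N`.
  set u := (1 + y) * |1 + y| ^ (q - 2) with hu
  set w := (1 - y) * |1 - y| ^ (q - 2) with hw
  have habs : ∀ t : ℝ, |t * |t| ^ (q - 2)| ^ p = |t| ^ q := by
    intro t
    rcases eq_or_ne t 0 with rfl | ht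
    · rw [zero_mul, abs_zero, Real.zero_rpow (by linarith), Real.zero_rpow (by linarith)]
    · have : 0 < |t| := abs_pos.2 ht
      rw [abs_mul, abs_of_nonneg (Real.rpow_nonneg (abs_nonneg t) _)]
      nth_rewrite 1 [← Real.rpow_one |t|]
      rw [← Real.rpow_add this, ← Real.rpow_mul this.le]
      congr 1
      linarith
  have hmul : ∀ t : ℝ, t * (t * |t| ^ (q - 2)) = |t| ^ q := by
    intro t
    rcases eq_or_ne t 0 with rfl | ht
    · rw [zero_mul, abs_zero, Real.zero_rpow (by linarith)]
    · have : 0 < |t| := abs_pos.2 ht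
      rw [← mul_assoc, ← pow_two, ← sq_abs, ← Real.rpow_two, ← Real.rpow_add this]
      congr 1
      ring
  have h1 := sq_add_rpow_le_two_point (a := (u + w) / 2) (b := (u - w) / 2) hp1 hp2
  have e1 : (u + w) / 2 + (u - w) / 2 = u := by ring
  have e2 : (u + w) / 2 - (u - w) / 2 = w := by ring
  rw [e1, e2, hu, hw, habs, habs, ← hu, ← hw, ← hN] at h1
  have hN' : N = (u + w) / 2 + y * ((u - w) / 2) := by
    rw [hN, ← hmul, ← hmul, ← hu, ← hw]; ring
  set α := (u + w) / 2
  set β := (u - w) / 2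
  -- Cauchy–Schwarz for `N = α + y β` with weights `1` and `p - 1`, using `(q - 1)(p - 1) = 1`. The
  -- last factor is then at most `N^(2/p)` by the `L^p → L²` inequality, and a power of `N` cancels.
  have hcs : N ^ 2 ≤ (1 + (q - 1) * y ^ 2) * (α ^ 2 + (p - 1) * β ^ 2) := by
    have : (1 + (q - 1) * y ^ 2) * (α ^ 2 + (p - 1) * β ^ 2) - N ^ 2
        = ((p - 1) * β - y * α) ^ 2 / (p - 1) := by
      rw [hN', hq1]
      field_simp
      ring
    have h2 : 0 ≤ ((p - 1) * β - y * α) ^ 2 / (p - 1) := by positivity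
    linarith
  have hM : α ^ 2 + (p - 1) * β ^ 2 ≤ N ^ (2 / p) := by
    have h2 : 0 ≤ α ^ 2 + (p - 1) * β ^ 2 := by positivity
    have := Real.rpow_le_rpow (by positivity) h1 (by positivity : 0 ≤ 2 / p)
    rwa [← Real.rpow_mul h2, show p / 2 * (2 / p) = 1 by field_simp, Real.rpow_one] at this
  have hC : 0 < 1 + (q - 1) * y ^ 2 := by nlinarith [sq_nonneg y]
  have h3 : N ^ (2 : ℝ) ≤ (1 + (q - 1) * y ^ 2) * N ^ (2 / p) := by
    rw [Real.rpow_two]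
    exact hcs.trans (by gcongr)
  have h4 : N ^ (2 / q) ≤ 1 + (q - 1) * y ^ 2 := by
    have e : (2 : ℝ) = 2 / q + 2 / p := by rw [hq]; field_simp; ring
    rw [show N ^ (2 : ℝ) = N ^ (2 / q) * N ^ (2 / p) by rw [← Real.rpow_add hNpos, ← e]] at h3
    exact le_of_mul_le_mul_right h3 (Real.rpow_pos_of_pos hNpos _)
  have := Real.rpow_le_rpow (by positivity) h4 (by positivity : 0 ≤ q / 2)
  rwa [← Real.rpow_mul hN0, show 2 / q * (q / 2) = 1 by field_simp, Real.rpow_one] at this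

/-! ### Two-point Minkowski inequalities, the complex two-point inequality and its tensorisation. -/

theorem two_point_minkowski {r a b c d : ℝ} (hr : 1 ≤ r) (ha : 0 ≤ a) (hb : 0 ≤ b)
    (hc : 0 ≤ c) (hd : 0 ≤ d) :
    ((a + c) ^ r + (b + d) ^ r) ^ (1 / r) ≤
      (a ^ r + b ^ r) ^ (1 / r) + (c ^ r + d ^ r) ^ (1 / r) := by
  have := Real.Lp_add_le_of_nonneg (s := (Finset.univ : Finset (Fin 2))) (f := ![a, b])
    (g := ![c, d]) hr (by intro i _; fin_cases i <;> simp [ha, hb])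
    (by intro i _; fin_cases i <;> simp [hc, hd])
  simpa [Fin.sum_univ_two] using this

theorem two_point_minkowski_sum {ι : Type*} (s : Finset ι) {r : ℝ} (hr : 1 ≤ r) {x y : ι → ℝ}
    (hx : ∀ i, 0 ≤ x i) (hy : ∀ i, 0 ≤ y i) :
    ((∑ i ∈ s, x i) ^ r + (∑ i ∈ s, y i) ^ r) ^ (1 / r) ≤
      ∑ i ∈ s, (x i ^ r + y i ^ r) ^ (1 / r) := by
  classical
  induction s using Finset.induction_on with
  | empty =>
    have h1 : r ≠ 0 := by linarith
    simp [Real.zero_rpow h1, Real.zero_rpow (inv_ne_zero h1)]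
  | insert i s hi ih =>
    rw [Finset.sum_insert hi, Finset.sum_insert hi, Finset.sum_insert hi]
    exact (two_point_minkowski hr (hx i) (hy i) (Finset.sum_nonneg fun i _ => hx i)
      (Finset.sum_nonneg fun i _ => hy i)).trans (by gcongr)

/-- Minkowski in `L^r` of the uniform measure on two points, one summand being constant. It is used
with `r = q / 2`. -/
theorem two_point_mean_add_const_le {r a b c : ℝ} (hr : 1 ≤ r) (ha : 0 ≤ a) (hb : 0 ≤ b)
    (hc : 0 ≤ c) :
    ((a + c) ^ r + (b + c) ^ r) / 2 ≤ (((a ^ r + b ^ r) / 2) ^ (1 / r) + c) ^ r := by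
  have hr0 : 0 < r := by linarith
  have h := two_point_minkowski hr ha hb hc hc
  have h2 : 0 < (1 / 2 : ℝ) ^ (1 / r) := by positivity
  have h3 := mul_le_mul_of_nonneg_left h h2.le
  rw [mul_add, ← Real.mul_rpow (by norm_num) (by positivity),
    ← Real.mul_rpow (by norm_num) (by positivity),
    ← Real.mul_rpow (by norm_num) (by positivity),
    show 1 / 2 * (c ^ r + c ^ r) = c ^ r by ring, ← Real.rpow_mul hc,
    show r * (1 / r) = 1 by field_simp, Real.rpow_one] at h3
  have h4 := Real.rpow_le_rpow (by positivity) h3 hr0.le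
  rw [← Real.rpow_mul (by positivity), show 1 / r * r = 1 by field_simp, Real.rpow_one] at h4
  calc _ = 1 / 2 * ((a + c) ^ r + (b + c) ^ r) := by ring
    _ ≤ _ := h4
    _ = _ := by congr 3; ring_nf

/-- Minkowski reverses for exponents at most `1`: apply the ordinary inequality with exponent `1 /
s` to `s`-th powers, exchanging the roles of summands and points. It is used with `s = p / 2`. -/
theorem mean_add_const_rpow_le_two_point {s a b c : ℝ} (hs0 : 0 < s) (hs1 : s ≤ 1) (ha : 0 ≤ a)
    (hb : 0 ≤ b) (hc : 0 ≤ c) :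
    (((a ^ s + b ^ s) / 2) ^ (1 / s) + c) ^ s ≤ ((a + c) ^ s + (b + c) ^ s) / 2 := by
  have hr : 1 ≤ 1 / s := by rw [le_div_iff₀ hs0]; linarith
  have hinv : ∀ t : ℝ, 0 ≤ t → (t ^ s) ^ (1 / s) = t := by
    intro t ht
    rw [← Real.rpow_mul ht, show s * (1 / s) = 1 by field_simp, Real.rpow_one]
  have hcs : 0 ≤ c ^ s := by positivity
  have h := two_point_minkowski (a := a ^ s / 2) (b := c ^ s / 2) (c := b ^ s / 2)
    (d := c ^ s / 2) hr (by positivity) (by positivity) (by positivity) (by positivity)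
  have key : ∀ t : ℝ, 0 ≤ t →
      ((t ^ s / 2) ^ (1 / s) + (c ^ s / 2) ^ (1 / s)) ^ (1 / (1 / s)) = (t + c) ^ s / 2 := by
    intro t ht
    rw [Real.div_rpow (by positivity) (by norm_num), Real.div_rpow (by positivity) (by norm_num),
      hinv t ht, hinv c hc, ← add_div, one_div_one_div, Real.div_rpow (by positivity)
      (by positivity), ← Real.rpow_mul (by norm_num), show 1 / s * s = 1 by field_simp,
      Real.rpow_one]
  rw [key a ha, key b hb, add_halves, hinv c hc, one_div_one_div, ← add_div, ← add_div] at h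
  exact h

theorem sq_rpow_half {x r : ℝ} (hx : 0 ≤ x) : (x ^ 2) ^ (r / 2) = x ^ r := by
  rw [← Real.rpow_two, ← Real.rpow_mul hx]
  congr 1
  ring

theorem norm_rpow_eq_re_im (z : ℂ) (r : ℝ) : ‖z‖ ^ r = (z.re ^ 2 + z.im ^ 2) ^ (r / 2) := by
  rw [← sq_rpow_half (norm_nonneg z), Complex.sq_norm, Complex.normSq_apply]
  congr 1
  ring

/-- The complex two-point inequality with imaginary parameter, normalised. -/
theorem complex_two_point_one {p q : ℝ} (hp1 : 1 < p) (hp2 : p < 2) (hq : q = p / (p - 1))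
    (b : ℂ) :
    ((‖1 + (√(p - 1) : ℝ) * Complex.I * b‖ ^ q + ‖1 - (√(p - 1) : ℝ) * Complex.I * b‖ ^ q) / 2)
      ^ (p / q) ≤ (‖1 + b‖ ^ p + ‖1 - b‖ ^ p) / 2 := by
  have hp0 : 0 < p - 1 := by linarith
  have hq2 : 2 < q := by rw [hq, lt_div_iff₀ hp0]; linarith
  have hpq : (q - 1) * (p - 1) = 1 := by rw [hq]; field_simp; ring
  set ω := √(p - 1) with hω
  have hω2 : ω ^ 2 = p - 1 := Real.sq_sqrt hp0.le
  set x := b.re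
  set y := b.im
  -- Both sides are compared with `K^(p/2)`. Multiplying by `iω` swaps real and imaginary parts. On
  -- the left `(p - 1) x²` is a constant removed by Minkowski in `L^(q/2)`, and the `L² → L^q`
  -- inequality at `ω y` gives `1 + y²`. On the right `y²` is a constant removed by reverse
  -- Minkowski in `L^(p/2)`, and the `L^p → L²` inequality gives `1 + (p - 1) x²`.
  set K := 1 + (p - 1) * x ^ 2 + y ^ 2 with hK
  have hK0 : 0 < K := by positivity
  have hL : (‖1 + (ω : ℝ) * Complex.I * b‖ ^ q + ‖1 - (ω : ℝ) * Complex.I * b‖ ^ q) / 2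
      ≤ K ^ (q / 2) := by
    have e1 : ‖1 + (ω : ℝ) * Complex.I * b‖ ^ q
        = (|1 - ω * y| ^ 2 + (p - 1) * x ^ 2) ^ (q / 2) := by
      rw [norm_rpow_eq_re_im, sq_abs, ← hω2]
      congr 1
      simp [x, y]
      ring
    have e2 : ‖1 - (ω : ℝ) * Complex.I * b‖ ^ q
        = (|1 + ω * y| ^ 2 + (p - 1) * x ^ 2) ^ (q / 2) := by
      rw [norm_rpow_eq_re_im, sq_abs, ← hω2]
      congr 1
      simp [x, y]
      ring
    rw [e1, e2]
    refine (two_point_mean_add_const_le (by linarith) (by positivity) (by positivity)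
      (by positivity)).trans ?_
    apply Real.rpow_le_rpow (by positivity) _ (by linarith)
    rw [sq_rpow_half (abs_nonneg _), sq_rpow_half (abs_nonneg _), add_comm (|1 - ω * y| ^ q)]
    have h := two_point_le_one_add_rpow (y := ω * y) hp1 hp2 hq
    rw [mul_pow, hω2, ← mul_assoc, hpq, one_mul] at h
    have h' := Real.rpow_le_rpow (by positivity) h (by positivity : 0 ≤ 1 / (q / 2))
    rw [← Real.rpow_mul (by positivity), show q / 2 * (1 / (q / 2)) = 1 by field_simp,
      Real.rpow_one] at h'
    linarith
  have hR : K ^ (p / 2) ≤ (‖1 + b‖ ^ p + ‖1 - b‖ ^ p) / 2 := by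
    have e1 : ‖1 + b‖ ^ p = (|1 + x| ^ 2 + y ^ 2) ^ (p / 2) := by
      rw [norm_rpow_eq_re_im, sq_abs]
      simp [x, y]
    have e2 : ‖1 - b‖ ^ p = (|1 - x| ^ 2 + y ^ 2) ^ (p / 2) := by
      rw [norm_rpow_eq_re_im, sq_abs]
      simp [x, y]
    rw [e1, e2]
    refine le_trans ?_ (mean_add_const_rpow_le_two_point (by linarith) (by linarith)
      (by positivity) (by positivity) (by positivity))
    apply Real.rpow_le_rpow (by positivity) _ (by linarith)
    rw [sq_rpow_half (abs_nonneg _), sq_rpow_half (abs_nonneg _)]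
    have h := one_add_rpow_le_two_point (x := x) hp1 hp2
    have h' := Real.rpow_le_rpow (by positivity) h (by positivity : 0 ≤ 1 / (p / 2))
    rw [← Real.rpow_mul (by positivity), show p / 2 * (1 / (p / 2)) = 1 by field_simp,
      Real.rpow_one] at h'
    linarith
  refine le_trans (Real.rpow_le_rpow (by positivity) hL (by positivity)) ?_
  rw [← Real.rpow_mul hK0.le, show q / 2 * (p / q) = p / 2 by field_simp]
  exact hR

/-- Beckner's complex two-point inequality. -/
theorem complex_two_point {p q : ℝ} (hp1 : 1 < p) (hp2 : p < 2) (hq : q = p / (p - 1))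
    (a b : ℂ) :
    ((‖a + (√(p - 1) : ℝ) * Complex.I * b‖ ^ q + ‖a - (√(p - 1) : ℝ) * Complex.I * b‖ ^ q) / 2)
      ^ (p / q) ≤ (‖a + b‖ ^ p + ‖a - b‖ ^ p) / 2 := by
  have hp0 : 0 < p - 1 := by linarith
  have hq2 : 2 < q := by rw [hq, lt_div_iff₀ hp0]; linarith
  rcases eq_or_ne a 0 with rfl | ha
  · have h1 : ‖((√(p - 1) : ℝ) : ℂ) * Complex.I * b‖ ≤ ‖b‖ := by
      rw [norm_mul, norm_mul, Complex.norm_I, mul_one, Complex.norm_real, Real.norm_eq_abs,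
        abs_of_nonneg (Real.sqrt_nonneg _)]
      exact mul_le_of_le_one_left (norm_nonneg _) (Real.sqrt_le_one.2 (by linarith))
    simp only [zero_add, zero_sub, norm_neg, add_self_div_two]
    rw [← Real.rpow_mul (norm_nonneg _), mul_div_cancel₀ _ (by linarith)]
    exact Real.rpow_le_rpow (norm_nonneg _) h1 (by linarith)
  · have h := complex_two_point_one hp1 hp2 hq (b / a)
    set ω := √(p - 1)
    have e1 : a + b = a * (1 + b / a) := by field_simp
    have e2 : a - b = a * (1 - b / a) := by field_simp
    have e3 : a + ω * Complex.I * b = a * (1 + ω * Complex.I * (b / a)) := by field_simp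
    have e4 : a - ω * Complex.I * b = a * (1 - ω * Complex.I * (b / a)) := by field_simp
    rw [e1, e2, e3, e4]
    simp only [norm_mul a, Real.mul_rpow (norm_nonneg a) (norm_nonneg _)]
    rw [← mul_add, ← mul_add, mul_div_assoc, mul_div_assoc,
      Real.mul_rpow (by positivity) (by positivity), ← Real.rpow_mul (norm_nonneg _),
      mul_div_cancel₀ _ (by linarith)]
    exact mul_le_mul_of_nonneg_left h (by positivity)

/-- Tensorised form of the complex two-point inequality, for sums of product functions on the
discrete cube. -/
theorem complex_hypercube {p q : ℝ} (hp1 : 1 < p) (hp2 : p < 2) (hq : q = p / (p - 1))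
    {κ : Type*} (s : Finset κ) (u v : κ → Bool → ℂ) (α β : κ → ℂ)
    (hut : ∀ k, u k true = α k + β k) (huf : ∀ k, u k false = α k - β k)
    (hvt : ∀ k, v k true = α k + (√(p - 1) : ℝ) * Complex.I * β k)
    (hvf : ∀ k, v k false = α k - (√(p - 1) : ℝ) * Complex.I * β k) (n : ℕ) (c : κ → ℂ) :
    ((∑ ε : Fin n → Bool, ‖∑ k ∈ s, c k * ∏ j, v k (ε j)‖ ^ q) / 2 ^ n) ^ (p / q) ≤
      (∑ ε : Fin n → Bool, ‖∑ k ∈ s, c k * ∏ j, u k (ε j)‖ ^ p) / 2 ^ n := by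
  have hp0 : 0 < p - 1 := by linarith
  have hq2 : 2 < q := by rw [hq, lt_div_iff₀ hp0]; linarith
  have hqp : 1 ≤ q / p := by rw [le_div_iff₀ (by linarith)]; linarith
  induction n generalizing c with
  | zero =>
    simp only [Finset.univ_unique, Finset.univ_eq_empty, Finset.prod_empty, mul_one,
      Finset.sum_singleton, pow_zero, div_one]
    rw [← Real.rpow_mul (norm_nonneg _), mul_div_cancel₀ _ (by linarith)]
  | succ n ih =>
    -- The first coordinate is peeled off and its factor absorbed into the coefficients, which is
    -- why the induction runs over all `c`.
    have split : ∀ (w : κ → Bool → ℂ) (r : ℝ),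
        (∑ ε : Fin (n + 1) → Bool, ‖∑ k ∈ s, c k * ∏ j, w k (ε j)‖ ^ r) / 2 ^ (n + 1)
        = ((∑ ε : Fin n → Bool, ‖∑ k ∈ s, (c k * w k true) * ∏ j, w k (ε j)‖ ^ r) / 2 ^ n +
          (∑ ε : Fin n → Bool, ‖∑ k ∈ s, (c k * w k false) * ∏ j, w k (ε j)‖ ^ r) / 2 ^ n)
          / 2 := by
      intro w r
      rw [← (Fin.consEquiv fun _ : Fin (n + 1) => Bool).sum_comp, Fintype.sum_prod_type,
        Fintype.sum_bool]
      simp only [Fin.consEquiv_apply, Fin.prod_univ_succ, Fin.cons_zero, Fin.cons_succ,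
        mul_assoc, pow_succ]
      field_simp
    rw [split v q, split u p]
    set r := q / p with hr
    have hr1 : p / q = 1 / r := by rw [hr]; field_simp
    set Ψ : (κ → ℂ) → (Fin n → Bool) → ℝ :=
      fun d ε => ‖∑ k ∈ s, d k * ∏ j, u k (ε j)‖ ^ p with hΨ
    have ih' : ∀ d : κ → ℂ,
        (∑ ε : Fin n → Bool, ‖∑ k ∈ s, d k * ∏ j, v k (ε j)‖ ^ q) / 2 ^ n ≤
        ((∑ ε, Ψ d ε) / 2 ^ n) ^ r := by
      intro d
      have h := Real.rpow_le_rpow (by positivity) (ih d) (by positivity : 0 ≤ r)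
      rwa [← Real.rpow_mul (by positivity), show p / q * r = 1 by rw [hr]; field_simp,
        Real.rpow_one] at h
    set ct : κ → ℂ := fun k => c k * v k true
    set cf : κ → ℂ := fun k => c k * v k false
    -- Since `q / p ≥ 1`, Minkowski moves the `L^(q/p)` norm in the first coordinate inside the sum
    -- over the remaining ones.
    have h1 : (((∑ ε, Ψ ct ε) / 2 ^ n) ^ r + ((∑ ε, Ψ cf ε) / 2 ^ n) ^ r) ^ (1 / r) ≤
        ∑ ε, ((Ψ ct ε / 2 ^ n) ^ r + (Ψ cf ε / 2 ^ n) ^ r) ^ (1 / r) := by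
      rw [Finset.sum_div, Finset.sum_div]
      exact two_point_minkowski_sum _ hqp (fun i => by positivity) (fun i => by positivity)
    -- With the other coordinates frozen, the first one carries the functions `A ± B` and `A ± iωB`,
    -- so this is the two-point inequality.
    have h2 : ∀ ε : Fin n → Bool,
        (1 / 2 : ℝ) ^ (1 / r) * ((Ψ ct ε / 2 ^ n) ^ r + (Ψ cf ε / 2 ^ n) ^ r) ^ (1 / r) ≤
        (‖∑ k ∈ s, (c k * u k true) * ∏ j, u k (ε j)‖ ^ p +
          ‖∑ k ∈ s, (c k * u k false) * ∏ j, u k (ε j)‖ ^ p) / 2 / 2 ^ n := by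
      intro ε
      set A := ∑ k ∈ s, c k * α k * ∏ j, u k (ε j)
      set B := ∑ k ∈ s, c k * β k * ∏ j, u k (ε j)
      have e1 : ∑ k ∈ s, ct k * ∏ j, u k (ε j) = A + (√(p - 1) : ℝ) * Complex.I * B := by
        simp only [A, B, ct, Finset.mul_sum, ← Finset.sum_add_distrib, hvt]
        exact Finset.sum_congr rfl fun k _ => by ring
      have e2 : ∑ k ∈ s, cf k * ∏ j, u k (ε j) = A - (√(p - 1) : ℝ) * Complex.I * B := by
        simp only [A, B, cf, Finset.mul_sum, ← Finset.sum_sub_distrib, hvf]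
        exact Finset.sum_congr rfl fun k _ => by ring
      have e3 : ∑ k ∈ s, (c k * u k true) * ∏ j, u k (ε j) = A + B := by
        simp only [A, B, ← Finset.sum_add_distrib, hut]
        exact Finset.sum_congr rfl fun k _ => by ring
      have e4 : ∑ k ∈ s, (c k * u k false) * ∏ j, u k (ε j) = A - B := by
        simp only [A, B, ← Finset.sum_sub_distrib, huf]
        exact Finset.sum_congr rfl fun k _ => by ring
      have h := complex_two_point hp1 hp2 hq A B
      rw [e3, e4]
      simp only [hΨ]
      rw [e1, e2]
      refine le_trans (le_of_eq ?_) (div_le_div_of_nonneg_right h (by positivity))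
      have hd : ∀ t : ℝ, 0 ≤ t → (t ^ p / 2 ^ n) ^ r = t ^ q / (2 ^ n) ^ r := by
        intro t ht
        rw [Real.div_rpow (by positivity) (by positivity), ← Real.rpow_mul ht,
          show p * r = q by rw [hr]; field_simp]
      have he : ((2 : ℝ) ^ n) = ((2 ^ n) ^ r) ^ (1 / r) := by
        rw [← Real.rpow_mul (by positivity), show r * (1 / r) = 1 by field_simp, Real.rpow_one]
      rw [hr1, hd _ (norm_nonneg _), hd _ (norm_nonneg _), ← add_div,
        ← Real.mul_rpow (by positivity) (by positivity), he,
        ← Real.div_rpow (by positivity) (by positivity), ← he]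
      congr 1
      ring
    calc _ ≤ ((((∑ ε, Ψ ct ε) / 2 ^ n) ^ r + ((∑ ε, Ψ cf ε) / 2 ^ n) ^ r) / 2) ^ (p / q) := by
          apply Real.rpow_le_rpow (by positivity) _ (by positivity)
          have := ih' ct
          have := ih' cf
          gcongr
      _ = (1 / 2 : ℝ) ^ (1 / r) *
          (((∑ ε, Ψ ct ε) / 2 ^ n) ^ r + ((∑ ε, Ψ cf ε) / 2 ^ n) ^ r) ^ (1 / r) := by
          rw [hr1, ← Real.mul_rpow (by positivity) (by positivity)]
          congr 1
          ring
      _ ≤ (1 / 2 : ℝ) ^ (1 / r) *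
          ∑ ε, ((Ψ ct ε / 2 ^ n) ^ r + (Ψ cf ε / 2 ^ n) ^ r) ^ (1 / r) := by gcongr
      _ ≤ ∑ ε : Fin n → Bool, (‖∑ k ∈ s, (c k * u k true) * ∏ j, u k (ε j)‖ ^ p +
          ‖∑ k ∈ s, (c k * u k false) * ∏ j, u k (ε j)‖ ^ p) / 2 / 2 ^ n := by
          rw [Finset.mul_sum]
          exact Finset.sum_le_sum fun ε _ => h2 ε
      _ = _ := by
          rw [← Finset.sum_div, ← Finset.sum_div, Finset.sum_add_distrib]
          ring

/-! ### Normalised sums of signs and the central limit theorem. -/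

/-- The sign attached to a Boolean. -/
def boolSign (b : Bool) : ℝ := if b then 1 else -1

/-- The normalised sum of `n` signs. -/
noncomputable def normalizedSignSum (n : ℕ) (ε : Fin n → Bool) : ℝ :=
  (∑ j, boolSign (ε j)) / √n

/-- The law of the normalised sum of `n` independent symmetric signs. -/
noncomputable def signSumLaw (n : ℕ) : Measure ℝ :=
  ∑ ε : Fin n → Bool, ((2 : ENNReal) ^ n)⁻¹ • Measure.dirac (normalizedSignSum n ε)

instance (n : ℕ) : IsProbabilityMeasure (signSumLaw n) where
  measure_univ := by
    simp only [signSumLaw, Measure.coe_finsetSum, Finset.sum_apply, Measure.smul_apply,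
      measure_univ, smul_eq_mul, mul_one, Finset.sum_const, Finset.card_univ, Fintype.card_pi,
      Fintype.card_bool, Finset.prod_const, Fintype.card_fin, nsmul_eq_mul]
    push_cast
    exact ENNReal.mul_inv_cancel (by simp) (by simp)

theorem integral_signSumLaw {E : Type*} [NormedAddCommGroup E] [NormedSpace ℝ E]
    [CompleteSpace E] (n : ℕ) (φ : ℝ → E) :
    ∫ x, φ x ∂signSumLaw n = ((2 : ℝ) ^ n)⁻¹ • ∑ ε, φ (normalizedSignSum n ε) := by
  have hi : ∀ ε : Fin n → Bool, Integrable φ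
      (((2 : ENNReal) ^ n)⁻¹ • Measure.dirac (normalizedSignSum n ε)) := fun ε =>
    (integrable_dirac (by simp)).smul_measure (by simp)
  rw [signSumLaw, integral_finsetSum_measure (fun ε _ => hi ε), Finset.smul_sum]
  refine Finset.sum_congr rfl fun ε _ => ?_
  rw [integral_smul_measure, integral_dirac]
  simp

theorem tendsto_inv_sqrt_nhdsNE : Tendsto (fun x : ℝ => (√x)⁻¹) atTop (𝓝[≠] 0) := by
  refine tendsto_nhdsWithin_iff.2 ⟨tendsto_inv_atTop_zero.comp Real.tendsto_sqrt_atTop, ?_⟩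
  filter_upwards [eventually_gt_atTop 0] with x hx
  exact inv_ne_zero (Real.sqrt_ne_zero'.2 hx)

theorem tendsto_sqrt_mul_of_hasDerivAt {g : ℝ → ℝ} {d : ℝ} (hg : HasDerivAt g d 0)
    (h0 : g 0 = 0) : Tendsto (fun x : ℝ => √x * g (√x)⁻¹) atTop (𝓝 d) := by
  have h := (hasDerivAt_iff_tendsto_slope_zero.1 hg).comp tendsto_inv_sqrt_nhdsNE
  refine h.congr fun x => ?_
  simp [h0]

theorem tendsto_mul_log_one_sub_sin_sq (c μ : ℝ) :
    Tendsto (fun x : ℝ => x * Real.log (1 - c * Real.sin (μ * (√x)⁻¹) ^ 2)) atTop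
      (𝓝 (-(c * μ ^ 2))) := by
  have hs : HasDerivAt (fun t : ℝ => Real.sin (μ * t)) μ 0 := by
    have h1 : HasDerivAt (fun t : ℝ => μ * t) (μ * 1) 0 := (hasDerivAt_id 0).const_mul μ
    exact h1.sin.congr_deriv (by simp)
  have h := tendsto_sqrt_mul_of_hasDerivAt hs (by simp)
  have h2 : Tendsto (fun x : ℝ => x * (-(c * Real.sin (μ * (√x)⁻¹) ^ 2))) atTop
      (𝓝 (-(c * μ ^ 2))) := by
    refine ((h.pow 2).const_mul c).neg.congr' ?_
    filter_upwards [eventually_ge_atTop 0] with x hx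
    rw [mul_pow, Real.sq_sqrt hx]
    ring
  simpa only [← sub_eq_add_neg] using Real.tendsto_mul_log_one_add_of_tendsto h2

theorem tendsto_cos_add_mul_sin_inv_sqrt (ω μ : ℝ) :
    Tendsto (fun x : ℝ => Real.cos (μ * (√x)⁻¹) + ω * Real.sin (μ * (√x)⁻¹)) atTop (𝓝 1) := by
  have hc : Continuous fun t : ℝ => Real.cos (μ * t) + ω * Real.sin (μ * t) := by fun_prop
  have h := (hc.tendsto 0).comp (tendsto_inv_sqrt_nhdsNE.mono_right nhdsWithin_le_nhds)
  simpa [Function.comp_def] using h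

theorem eventually_cos_add_mul_sin_pos (ω μ : ℝ) :
    ∀ᶠ x : ℝ in atTop, 0 < Real.cos (μ * (√x)⁻¹) + ω * Real.sin (μ * (√x)⁻¹) :=
  (tendsto_cos_add_mul_sin_inv_sqrt ω μ).eventually (lt_mem_nhds one_pos)

theorem charFun_signSumLaw (n : ℕ) (t : ℝ) :
    charFun (signSumLaw n) t = ((Real.cos (t * (√n)⁻¹) ^ n : ℝ) : ℂ) := by
  rw [charFun_apply_real, integral_signSumLaw]
  have h1 : ∀ ε : Fin n → Bool, Complex.exp (t * (normalizedSignSum n ε : ℝ) * Complex.I)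
      = ∏ j, Complex.exp ((t * (√n)⁻¹ * boolSign (ε j) : ℝ) * Complex.I) := by
    intro ε
    rw [← Complex.exp_sum, normalizedSignSum]
    congr 1
    push_cast
    rw [← Finset.sum_mul, ← Finset.mul_sum]
    ring
  simp only [h1]
  rw [← Fintype.prod_sum (f := fun (_ : Fin n) (b : Bool) =>
    Complex.exp ((t * (√n)⁻¹ * boolSign b : ℝ) * Complex.I))]
  simp only [Fintype.sum_bool, boolSign, if_true, Bool.false_eq_true, if_false, Finset.prod_const,
    Finset.card_univ, Fintype.card_fin]
  have h2 : Complex.exp ((t * (√n)⁻¹ * 1 : ℝ) * Complex.I)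
      + Complex.exp ((t * (√n)⁻¹ * -1 : ℝ) * Complex.I) = 2 * Complex.cos (t * (√n)⁻¹ : ℝ) := by
    rw [Complex.cos]
    push_cast
    ring_nf
  rw [h2, mul_pow, Complex.real_smul]
  push_cast
  rw [← mul_assoc, inv_mul_cancel₀ (pow_ne_zero _ two_ne_zero), one_mul]

/-- Write `cos^n = exp ((n / 2) log (1 - sin²))`, legitimate once the cosine is positive. This is
the convergence of characteristic functions that yields the central limit theorem. -/
theorem tendsto_cos_pow (t : ℝ) :
    Tendsto (fun n : ℕ => Real.cos (t * (√n)⁻¹) ^ n) atTop (𝓝 (Real.exp (-t ^ 2 / 2))) := by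
  have h1 := ((tendsto_mul_log_one_sub_sin_sq 1 t).comp tendsto_natCast_atTop_atTop).div_const 2
  have h2 := (Real.continuous_exp.tendsto _).comp h1
  rw [one_mul] at h2
  refine h2.congr' ?_
  filter_upwards [tendsto_natCast_atTop_atTop.eventually (eventually_cos_add_mul_sin_pos 0 t)]
    with n hn
  simp only [zero_mul, add_zero] at hn
  simp only [Function.comp_apply, one_mul]
  rw [← Real.cos_sq', Real.log_pow, ← Real.rpow_natCast, Real.rpow_def_of_pos hn]
  congr 1
  push_cast
  ring

/-- `signSumLaw` as a `ProbabilityMeasure`. -/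
noncomputable def signSumProb (n : ℕ) : ProbabilityMeasure ℝ := ⟨signSumLaw n, inferInstance⟩

/-- The standard Gaussian as a `ProbabilityMeasure`. -/
noncomputable def gaussianProb : ProbabilityMeasure ℝ :=
  ⟨ProbabilityTheory.gaussianReal 0 1, inferInstance⟩

theorem tendsto_signSumProb : Tendsto signSumProb atTop (𝓝 gaussianProb) := by
  refine ProbabilityMeasure.tendsto_of_tendsto_charFun fun t => ?_
  simp only [signSumProb, gaussianProb, ProbabilityMeasure.coe_mk]
  rw [ProbabilityTheory.charFun_gaussianReal]
  simp only [charFun_signSumLaw]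
  have := (Complex.continuous_ofReal.tendsto _).comp (tendsto_cos_pow t)
  convert! this using 2
  push_cast
  congr 1
  ring

theorem tendsto_integral_signSumLaw {φ : ℝ → ℝ} (hφ : Continuous φ) {C : ℝ}
    (hC : ∀ x, |φ x| ≤ C) :
    Tendsto (fun n => ∫ x, φ x ∂signSumLaw n) atTop
      (𝓝 (∫ x, φ x ∂ProbabilityTheory.gaussianReal 0 1)) :=
  ProbabilityMeasure.tendsto_iff_forall_integral_tendsto.1 tendsto_signSumProb
    (BoundedContinuousFunction.ofNormedAddCommGroup φ hφ C hC)

/-- Limit of integrals against `signSumLaw` of a family depending on converging parameters. -/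
theorem tendsto_integral_signSumLaw_param {α : Type*} [UniformSpace α]
    [WeaklyLocallyCompactSpace α] {Φ : α → ℝ → ℝ} (hΦ : Continuous (Function.uncurry Φ)) {K : Set ℝ}
    (hK : IsCompact K) (hsupp : ∀ w, ∀ x ∉ K, Φ w x = 0) {w : ℕ → α} {w₀ : α}
    (hw : Tendsto w atTop (𝓝 w₀)) :
    Tendsto (fun n => ∫ x, Φ (w n) x ∂signSumLaw n) atTop
      (𝓝 (∫ x, Φ w₀ x ∂ProbabilityTheory.gaussianReal 0 1)) := by
  have hcont : ∀ w, Continuous (Φ w) := fun w => hΦ.comp (Continuous.prodMk_right w)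
  obtain ⟨C, hC⟩ := hK.exists_bound_of_continuousOn (hcont w₀).continuousOn
  have hbd : ∀ x, |Φ w₀ x| ≤ max C 0 := by
    intro x
    by_cases hx : x ∈ K
    · exact (hC x hx).trans (le_max_left _ _)
    · rw [hsupp w₀ x hx, abs_zero]; exact le_max_right _ _
  have h1 := tendsto_integral_signSumLaw (hcont w₀) hbd
  -- Weak convergence handles the fixed integrand `Φ w₀`. Moving the parameter costs little because
  -- `Φ w → Φ w₀` uniformly on `K`, everything vanishes off `K`, and each law has mass one.
  have hdiff : Tendsto (fun n => ∫ x, Φ (w n) x ∂signSumLaw n - ∫ x, Φ w₀ x ∂signSumLaw n)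
      atTop (𝓝 0) := by
    have : CompactSpace K := isCompact_iff_compactSpace.1 hK
    have hu : TendstoUniformly (fun w (x : K) => Φ w x) (fun x : K => Φ w₀ x) (𝓝 w₀) := by
      refine Continuous.tendstoUniformly (fun w (x : K) => Φ w x) ?_ w₀
      exact hΦ.comp (continuous_fst.prodMk (continuous_subtype_val.comp continuous_snd))
    rw [Metric.tendsto_nhds]
    intro δ hδ
    filter_upwards [hw.eventually (Metric.tendstoUniformly_iff.1 hu (δ / 2) (by positivity))]
      with n hn
    rw [dist_zero_right, integral_signSumLaw, integral_signSumLaw, ← smul_sub,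
      ← Finset.sum_sub_distrib, norm_smul]
    have h3 : ∀ x, ‖Φ (w n) x - Φ w₀ x‖ ≤ δ / 2 := by
      intro x
      by_cases hx : x ∈ K
      · have := (hn ⟨x, hx⟩).le
        rwa [dist_comm, dist_eq_norm] at this
      · rw [hsupp _ x hx, hsupp _ x hx, sub_zero, norm_zero]; positivity
    have h4 : ‖∑ ε, (Φ (w n) (normalizedSignSum n ε) - Φ w₀ (normalizedSignSum n ε))‖
        ≤ 2 ^ n * (δ / 2) := by
      refine (norm_sum_le_of_le _ fun ε _ => h3 _).trans (le_of_eq ?_)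
      simp
    have h5 : ‖((2 : ℝ) ^ n)⁻¹‖ = (2 ^ n)⁻¹ := Real.norm_of_nonneg (by positivity)
    rw [h5]
    calc _ ≤ ((2 : ℝ) ^ n)⁻¹ * (2 ^ n * (δ / 2)) := by gcongr
      _ = δ / 2 := by field_simp
      _ < δ := by linarith
  simpa using hdiff.add h1

/-! ### Exponentials on the cube and their images under the imaginary-parameter operator. -/

/-- The factor `cos θ + ω sin θ` at `θ = μ / √n`. -/
noncomputable def signFactor (ω μ : ℝ) (n : ℕ) : ℝ :=
  Real.cos (μ * (√n)⁻¹) + ω * Real.sin (μ * (√n)⁻¹)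

/-- The coefficients of the affine exponent of a product of `n` factors `signFactor`. -/
noncomputable def signExponent (ω μ : ℝ) (n : ℕ) : ℝ × ℝ :=
  (n * ((Real.log (signFactor (-ω) μ n) + Real.log (signFactor ω μ n)) / 2),
    √n * ((Real.log (signFactor (-ω) μ n) - Real.log (signFactor ω μ n)) / 2))

theorem eventually_signFactor_pos (ω μ : ℝ) : ∀ᶠ n : ℕ in atTop, 0 < signFactor ω μ n :=
  tendsto_natCast_atTop_atTop.eventually (eventually_cos_add_mul_sin_pos ω μ)

/-- The product of the two factors is `cos² - ω² sin² = 1 - (1 + ω²) sin²`, which gives the first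
limit; the second is a derivative at `0`. Together they show that `e^{iμx}` is sent to `exp (-(1 +
ω²) μ² / 2 - ω μ x)`, the Mehler image with parameter `iω`. -/
theorem tendsto_signExponent (ω μ : ℝ) :
    Tendsto (signExponent ω μ) atTop (𝓝 (-((1 + ω ^ 2) * μ ^ 2 / 2), -(ω * μ))) := by
  refine Tendsto.prodMk_nhds ?_ ?_
  · have h := ((tendsto_mul_log_one_sub_sin_sq (1 + ω ^ 2) μ).comp
      tendsto_natCast_atTop_atTop).div_const 2
    rw [neg_div] at h
    refine h.congr' ?_
    filter_upwards [eventually_signFactor_pos (-ω) μ, eventually_signFactor_pos ω μ] with n h1 h2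
    rw [← Real.log_mul h1.ne' h2.ne', Function.comp_apply, mul_div_assoc]
    congr 3
    simp only [signFactor]
    linear_combination -Real.sin_sq_add_cos_sq (μ * (√n)⁻¹)
  · have hd : HasDerivAt (fun t : ℝ =>
        (Real.log (Real.cos (μ * t) + -ω * Real.sin (μ * t)) -
          Real.log (Real.cos (μ * t) + ω * Real.sin (μ * t))) / 2) (-(ω * μ)) 0 := by
      have h1 : HasDerivAt (fun t : ℝ => μ * t) (μ * 1) 0 := (hasDerivAt_id 0).const_mul _
      have h2 := (h1.cos.add (h1.sin.const_mul (-ω))).log (by simp)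
      have h3 := (h1.cos.add (h1.sin.const_mul ω)).log (by simp)
      refine ((h2.sub h3).div_const 2).congr_deriv ?_
      simp
      ring
    exact (tendsto_sqrt_mul_of_hasDerivAt hd (by simp)).comp tendsto_natCast_atTop_atTop

theorem sum_boolSign {n : ℕ} (hn : 0 < n) (ε : Fin n → Bool) :
    ∑ j, boolSign (ε j) = √n * normalizedSignSum n ε := by
  have hsn : √(n : ℝ) ≠ 0 := Real.sqrt_ne_zero'.2 (by exact_mod_cast hn)
  rw [normalizedSignSum]
  field_simp

theorem prod_exp_boolSign {n : ℕ} (hn : 0 < n) (μ : ℝ) (ε : Fin n → Bool) :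
    ∏ j, Complex.exp ((μ * (√n)⁻¹ * boolSign (ε j) : ℝ) * Complex.I)
      = Complex.exp ((μ * normalizedSignSum n ε : ℝ) * Complex.I) := by
  have hsn : √(n : ℝ) ≠ 0 := Real.sqrt_ne_zero'.2 (by exact_mod_cast hn)
  rw [← Complex.exp_sum, ← Finset.sum_mul, ← Complex.ofReal_sum, ← Finset.mul_sum,
    sum_boolSign hn]
  congr 3
  field_simp

/-- A positive function of one sign is the exponential of an affine function of that sign, so the
product depends on the signs only through their sum. -/
theorem prod_signFactor {n : ℕ} (hn : 0 < n) {ω μ : ℝ} (hP : 0 < signFactor (-ω) μ n)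
    (hQ : 0 < signFactor ω μ n) (ε : Fin n → Bool) :
    ∏ j, (if ε j then ((signFactor (-ω) μ n : ℝ) : ℂ) else ((signFactor ω μ n : ℝ) : ℂ))
      = Complex.exp (((signExponent ω μ n).1
        + (signExponent ω μ n).2 * normalizedSignSum n ε : ℝ) : ℂ) := by
  simp only [signExponent]
  set P := signFactor (-ω) μ n
  set Q := signFactor ω μ n
  have h1 : ∀ b : Bool, (if b then (P : ℂ) else (Q : ℂ))
      = Complex.exp (((Real.log P + Real.log Q) / 2
        + (Real.log P - Real.log Q) / 2 * boolSign b : ℝ) : ℂ) := by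
    intro b
    rw [← Complex.ofReal_exp]
    cases b
    · simp only [boolSign, Bool.false_eq_true, if_false]
      rw [show (Real.log P + Real.log Q) / 2 + (Real.log P - Real.log Q) / 2 * -1 = Real.log Q
        by ring, Real.exp_log hQ]
    · simp only [boolSign, if_true]
      rw [show (Real.log P + Real.log Q) / 2 + (Real.log P - Real.log Q) / 2 * 1 = Real.log P
        by ring, Real.exp_log hP]
  simp only [h1]
  rw [← Complex.exp_sum, ← Complex.ofReal_sum, Finset.sum_add_distrib, ← Finset.mul_sum,
    sum_boolSign hn]
  congr 2
  simp only [Finset.sum_const, Finset.card_univ, Fintype.card_fin, nsmul_eq_mul]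
  ring

/-- With `θ = μ_k / √n`, `e^{±iθ} = cos θ ± i sin θ`; multiplying the odd part by `iω` gives `cos θ
∓ ω sin θ`. Large `n` makes these factors positive, so that they can be written as exponentials. -/
theorem signSumLaw_hypercontractivity {p q : ℝ} (hp1 : 1 < p) (hp2 : p < 2)
    (hq : q = p / (p - 1)) {κ : Type*} [Fintype κ] (c : κ → ℂ) (μ : κ → ℝ) :
    ∀ᶠ n : ℕ in atTop,
      ∫ x, ‖∑ k, c k * Complex.exp (((signExponent √(p - 1) (μ k) n).1
        + (signExponent √(p - 1) (μ k) n).2 * x : ℝ) : ℂ)‖ ^ q ∂signSumLaw n ≤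
      (∫ x, ‖∑ k, c k * Complex.exp ((μ k * x : ℝ) * Complex.I)‖ ^ p ∂signSumLaw n)
        ^ (q / p) := by
  have hp0 : 0 < p - 1 := by linarith
  have hq2 : 2 < q := by rw [hq, lt_div_iff₀ hp0]; linarith
  have hPQ : ∀ᶠ n : ℕ in atTop, ∀ k, 0 < signFactor (-√(p - 1)) (μ k) n ∧
      0 < signFactor √(p - 1) (μ k) n :=
    eventually_all.2 fun k => (eventually_signFactor_pos _ _).and (eventually_signFactor_pos _ _)
  filter_upwards [hPQ, eventually_gt_atTop 0] with n hn hn0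
  have h := complex_hypercube hp1 hp2 hq (Finset.univ : Finset κ)
    (fun k b => Complex.exp ((μ k * (√n)⁻¹ * boolSign b : ℝ) * Complex.I))
    (fun k b => if b then ((signFactor (-√(p - 1)) (μ k) n : ℝ) : ℂ)
      else ((signFactor √(p - 1) (μ k) n : ℝ) : ℂ))
    (fun k => Complex.cos (μ k * (√n)⁻¹ : ℝ))
    (fun k => Complex.sin (μ k * (√n)⁻¹ : ℝ) * Complex.I)
    (fun k => by rw [← Complex.exp_mul_I]; simp [boolSign])
    (fun k => by
      rw [sub_eq_add_neg, ← neg_mul, ← Complex.sin_neg, ← Complex.cos_neg, ← Complex.exp_mul_I]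
      simp [boolSign])
    (fun k => by
      simp only [if_true, signFactor]
      push_cast
      linear_combination -(√(p - 1) * Complex.sin (μ k * (√n : ℂ)⁻¹)) * Complex.I_sq)
    (fun k => by
      simp only [Bool.false_eq_true, if_false, signFactor]
      push_cast
      linear_combination (√(p - 1) * Complex.sin (μ k * (√n : ℂ)⁻¹)) * Complex.I_sq) n c
  simp only [prod_exp_boolSign hn0, prod_signFactor hn0 (hn _).1 (hn _).2] at h
  have h' := Real.rpow_le_rpow (by positivity) h (by positivity : 0 ≤ q / p)
  rw [← Real.rpow_mul (by positivity), show p / q * (q / p) = 1 by field_simp,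
    Real.rpow_one] at h'
  simp only [integral_signSumLaw, smul_eq_mul, ← div_eq_inv_mul]
  exact h'

/-! ### Passage to the Gaussian limit. -/

/-- A continuous cutoff function equal to `1` on `[-m, m]` and to `0` off `[-m - 1, m + 1]`. -/
noncomputable def cutoff (m : ℕ) (x : ℝ) : ℝ := max 0 (min 1 (m + 1 - |x|))

theorem cutoff_nonneg (m : ℕ) (x : ℝ) : 0 ≤ cutoff m x := le_max_left _ _

theorem cutoff_le_one (m : ℕ) (x : ℝ) : cutoff m x ≤ 1 := max_le zero_le_one (min_le_left _ _)

theorem continuous_cutoff (m : ℕ) : Continuous (cutoff m) := by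
  unfold cutoff
  fun_prop

theorem cutoff_eq_zero {m : ℕ} {x : ℝ} (hx : x ∉ Metric.closedBall (0 : ℝ) (m + 1)) :
    cutoff m x = 0 := by
  simp only [Metric.mem_closedBall, dist_zero_right, Real.norm_eq_abs, not_le] at hx
  exact max_eq_left ((min_le_right _ _).trans (by linarith))

theorem cutoff_eq_one {m : ℕ} {x : ℝ} (hx : |x| ≤ m) : cutoff m x = 1 := by
  rw [cutoff, min_eq_left (by linarith), max_eq_right zero_le_one]

theorem hasCompactSupport_cutoff (m : ℕ) : HasCompactSupport (cutoff m) :=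
  HasCompactSupport.intro (isCompact_closedBall (0 : ℝ) (m + 1)) fun _ hx => cutoff_eq_zero hx

/-- Fatou, since at each point the cutoffs are eventually `1`. It is needed because the real
exponentials in the limit are unbounded and weak convergence does not apply to them directly. -/
theorem lintegral_ofReal_le_of_cutoff {ν : Measure ℝ} [IsFiniteMeasure ν] {G : ℝ → ℝ}
    (hG : Continuous G) (hG0 : ∀ x, 0 ≤ G x) {C : ℝ}
    (hC : ∀ m, ∫ x, cutoff m x * G x ∂ν ≤ C) :
    ∫⁻ x, ENNReal.ofReal (G x) ∂ν ≤ ENNReal.ofReal C := by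
  have hInt : ∀ m, Integrable (fun x => cutoff m x * G x) ν := fun m =>
    Continuous.integrable_of_hasCompactSupport ((continuous_cutoff m).mul hG)
      (hasCompactSupport_cutoff m).mul_right
  have hlint : ∀ m, ∫⁻ x, ENNReal.ofReal (cutoff m x * G x) ∂ν ≤ ENNReal.ofReal C := by
    intro m
    rw [← ofReal_integral_eq_lintegral_ofReal (hInt m)
      (ae_of_all _ fun x => mul_nonneg (cutoff_nonneg m x) (hG0 x))]
    exact ENNReal.ofReal_le_ofReal (hC m)
  have hpt : ∀ x, Tendsto (fun m : ℕ => ENNReal.ofReal (cutoff m x * G x)) atTop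
      (𝓝 (ENNReal.ofReal (G x))) := by
    intro x
    refine tendsto_const_nhds.congr' ?_
    filter_upwards [tendsto_natCast_atTop_atTop.eventually (eventually_ge_atTop |x|)] with m hm
    rw [cutoff_eq_one hm, one_mul]
  calc ∫⁻ x, ENNReal.ofReal (G x) ∂ν
      = ∫⁻ x, liminf (fun m : ℕ => ENNReal.ofReal (cutoff m x * G x)) atTop ∂ν :=
        lintegral_congr fun x => ((hpt x).liminf_eq).symm
    _ ≤ liminf (fun m : ℕ => ∫⁻ x, ENNReal.ofReal (cutoff m x * G x) ∂ν) atTop :=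
        lintegral_liminf_le fun m => ((continuous_cutoff m).mul hG).measurable.ennreal_ofReal
    _ ≤ ENNReal.ofReal C := liminf_le_of_frequently_le' (Frequently.of_forall hlint)

theorem tendsto_integral_trigPoly_rpow {p : ℝ} (hp : 0 < p) {κ : Type*} [Fintype κ] (c : κ → ℂ)
    (μ : κ → ℝ) :
    Tendsto (fun n => ∫ x, ‖∑ k, c k * Complex.exp ((μ k * x : ℝ) * Complex.I)‖ ^ p
      ∂signSumLaw n) atTop
      (𝓝 (∫ x, ‖∑ k, c k * Complex.exp ((μ k * x : ℝ) * Complex.I)‖ ^ p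
        ∂ProbabilityTheory.gaussianReal 0 1)) := by
  refine tendsto_integral_signSumLaw (C := (∑ k, ‖c k‖) ^ p) ?_ ?_
  · refine Continuous.rpow_const ?_ (fun _ => Or.inr hp.le)
    fun_prop
  · intro x
    rw [abs_of_nonneg (by positivity)]
    refine Real.rpow_le_rpow (norm_nonneg _) (norm_sum_le_of_le _ fun k _ => ?_) hp.le
    rw [norm_mul, Complex.norm_exp_ofReal_mul_I, mul_one]

/-- Gaussian hypercontractivity with imaginary parameter, for trigonometric polynomials. -/
theorem gaussian_complex_hypercontractivity {p q : ℝ} (hp1 : 1 < p) (hp2 : p < 2)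
    (hq : q = p / (p - 1)) {κ : Type*} [Fintype κ] (c : κ → ℂ) (μ : κ → ℝ) :
    ∫⁻ x, ENNReal.ofReal (‖∑ k, c k * Complex.exp
      ((-(p * μ k ^ 2 / 2) + -(√(p - 1) * μ k) * x : ℝ) : ℂ)‖ ^ q)
        ∂ProbabilityTheory.gaussianReal 0 1 ≤
    ENNReal.ofReal ((∫ x, ‖∑ k, c k * Complex.exp ((μ k * x : ℝ) * Complex.I)‖ ^ p
        ∂ProbabilityTheory.gaussianReal 0 1) ^ (q / p)) := by
  have hp0 : 0 < p - 1 := by linarith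
  have hq2 : 2 < q := by rw [hq, lt_div_iff₀ hp0]; linarith
  let G : (κ → ℝ × ℝ) → ℝ → ℝ := fun w x =>
    ‖∑ k, c k * Complex.exp (((w k).1 + (w k).2 * x : ℝ) : ℂ)‖ ^ q
  have hGc : Continuous (Function.uncurry G) := by
    refine Continuous.rpow_const ?_ (fun _ => Or.inr (by linarith))
    fun_prop
  have hG0 : ∀ w x, 0 ≤ G w x := fun w x => Real.rpow_nonneg (norm_nonneg _) _
  have hw : Tendsto (fun n k => signExponent √(p - 1) (μ k) n) atTop
      (𝓝 fun k => (-(p * μ k ^ 2 / 2), -(√(p - 1) * μ k))) := by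
    refine tendsto_pi_nhds.2 fun k => ?_
    have h := tendsto_signExponent √(p - 1) (μ k)
    rwa [Real.sq_sqrt hp0.le, add_sub_cancel] at h
  let w₀ : κ → ℝ × ℝ := fun k => (-(p * μ k ^ 2 / 2), -(√(p - 1) * μ k))
  have hGw : Continuous (G w₀) := hGc.uncurry_left w₀
  have key : ∀ C : ℝ, (∀ m, ∫ x, cutoff m x * G w₀ x ∂ProbabilityTheory.gaussianReal 0 1 ≤ C) →
      ∫⁻ x, ENNReal.ofReal (G w₀ x) ∂ProbabilityTheory.gaussianReal 0 1 ≤ ENNReal.ofReal C :=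
    fun C hC => lintegral_ofReal_le_of_cutoff hGw (hG0 w₀) hC
  -- On the left, the cutoff makes the limit in `n` legitimate and only decreases the integral for
  -- finite `n`. On the right, trigonometric polynomials are bounded and need no cutoff.
  refine key _ fun m => ?_
  have hlim := tendsto_integral_signSumLaw_param (Φ := fun w x => cutoff m x * G w x)
    (((continuous_cutoff m).comp continuous_snd).mul hGc) (isCompact_closedBall (0 : ℝ) (m + 1))
    (fun w x hx => by rw [cutoff_eq_zero hx, zero_mul]) hw
  refine le_of_tendsto_of_tendsto hlim
    ((tendsto_integral_trigPoly_rpow (by linarith) c μ).rpow_const (Or.inr (by positivity))) ?_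
  filter_upwards [signSumLaw_hypercontractivity hp1 hp2 hq c μ] with n hn
  refine le_trans ?_ hn
  rw [integral_signSumLaw, integral_signSumLaw, smul_eq_mul, smul_eq_mul]
  refine mul_le_mul_of_nonneg_left (Finset.sum_le_sum fun ε _ => ?_) (by positivity)
  exact mul_le_of_le_one_left (hG0 _ _) (cutoff_le_one m _)

/-! ### Sharp Hausdorff–Young for trigonometric polynomials times a Gaussian. -/

/-- The Fourier transform on the line, with kernel `exp (-2πixξ)`. -/
noncomputable def lineFourier (h : ℝ → ℂ) (ξ : ℝ) : ℂ :=
  ∫ x, h x * Complex.exp (-(2 * Real.pi * Complex.I * x * ξ))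

theorem norm_exp_neg_two_pi (x ξ : ℝ) :
    ‖Complex.exp (-(2 * Real.pi * Complex.I * x * ξ))‖ = 1 := by
  have : -(2 * Real.pi * Complex.I * x * ξ) = ((-(2 * Real.pi * x * ξ) : ℝ) : ℂ) * Complex.I := by
    push_cast; ring
  rw [this, Complex.norm_exp_ofReal_mul_I]

theorem norm_exp_two_pi (x ξ : ℝ) :
    ‖Complex.exp (2 * Real.pi * Complex.I * x * ξ)‖ = 1 := by
  have : 2 * Real.pi * Complex.I * x * ξ = ((2 * Real.pi * x * ξ : ℝ) : ℂ) * Complex.I := by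
    push_cast; ring
  rw [this, Complex.norm_exp_ofReal_mul_I]

theorem integrable_mul_exp_neg_two_pi {h : ℝ → ℂ} (hh : Integrable h) (ξ : ℝ) :
    Integrable fun x : ℝ => h x * Complex.exp (-(2 * Real.pi * Complex.I * x * ξ)) := by
  refine hh.mul_bdd (c := 1) (Continuous.aestronglyMeasurable (by fun_prop))
    (ae_of_all _ fun x => (norm_exp_neg_two_pi x ξ).le)

theorem continuous_lineFourier {h : ℝ → ℂ} (hh : Integrable h) : Continuous (lineFourier h) := by
  refine continuous_of_dominated (bound := fun x => ‖h x‖) ?_ ?_ hh.norm ?_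
  · exact fun ξ => (integrable_mul_exp_neg_two_pi hh ξ).aestronglyMeasurable
  · exact fun ξ => ae_of_all _ fun x => by rw [norm_mul, norm_exp_neg_two_pi, mul_one]
  · exact ae_of_all _ fun x => by fun_prop

theorem eLpNorm_ofReal_eq {α E : Type*} [MeasurableSpace α] [NormedAddCommGroup E]
    {ν : Measure α} (f : α → E) {r : ℝ} (hr : 0 < r) :
    eLpNorm f (ENNReal.ofReal r) ν = (∫⁻ x, ENNReal.ofReal (‖f x‖ ^ r) ∂ν) ^ (1 / r) := by
  rw [eLpNorm_eq_lintegral_rpow_enorm_toReal (by simpa using hr) ENNReal.ofReal_ne_top,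
    ENNReal.toReal_ofReal hr.le]
  congr 1
  refine lintegral_congr fun x => ?_
  rw [← ENNReal.ofReal_rpow_of_nonneg (norm_nonneg _) hr.le, ofReal_norm]

theorem becknerConst_pos {p : ℝ} (hp1 : 1 < p) : 0 < becknerConst p := by
  have : 0 < p - 1 := by linarith
  unfold becknerConst
  positivity

/-- Collects the normalisations: `√(2π)` and its power `-q/p` from the Gaussian density on the two
sides, `√(2πp)^q` from the Gaussian integral, and `√(p-1)/(2πp)` from the dilation of the frequency.
The identity is checked on logarithms. -/
theorem becknerConst_rpow {p q : ℝ} (hp1 : 1 < p) (hq : q = p / (p - 1)) :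
    √(2 * Real.pi) * (√(2 * Real.pi * p)) ^ q * (√(p - 1) / (2 * Real.pi * p))
      * (√(2 * Real.pi))⁻¹ ^ (q / p) = becknerConst p ^ q := by
  have hp0 : 0 < p - 1 := by linarith
  have hp : 0 < p := by linarith
  have hpi := Real.pi_pos
  have hq0 : 0 < q := by rw [hq]; positivity
  have hB := becknerConst_pos hp1
  apply Real.log_injOn_pos (Set.mem_Ioi.2 (by positivity)) (Set.mem_Ioi.2 (by positivity))
  have hR : Real.log (becknerConst p) = 1 / (2 * p) * Real.log p +
      -(1 / (2 * (p / (p - 1)))) * (Real.log p - Real.log (p - 1)) := by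
    rw [becknerConst, Real.log_mul (by positivity) (by positivity), Real.log_rpow hp,
      Real.log_rpow (by positivity), Real.log_div (by positivity) (by positivity)]
  have hL : Real.log (√(2 * Real.pi)) = (Real.log 2 + Real.log Real.pi) / 2 := by
    rw [Real.log_sqrt (by positivity), Real.log_mul (by positivity) (by positivity)]
  have hM : Real.log (2 * Real.pi * p) = Real.log 2 + Real.log Real.pi + Real.log p := by
    rw [Real.log_mul (by positivity) (by positivity), Real.log_mul (by positivity) (by positivity)]
  rw [Real.log_rpow hB, hR, Real.log_mul (by positivity) (by positivity),
    Real.log_mul (by positivity) (by positivity), Real.log_mul (by positivity) (by positivity),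
    Real.log_rpow (by positivity), Real.log_rpow (by positivity),
    Real.log_div (by positivity) (by positivity), Real.log_inv, hL, hM,
    Real.log_sqrt (by positivity), Real.log_sqrt (by positivity), hM, hq]
  field_simp
  ring

theorem lineFourier_trigPoly_gaussian {p q : ℝ} (hp1 : 1 < p) (hq : q = p / (p - 1))
    {κ : Type*} [Fintype κ] (c : κ → ℂ) (μ : κ → ℝ) (y : ℝ) :
    lineFourier (fun x => (∑ k, c k * Complex.exp ((μ k * x : ℝ) * Complex.I)) *
      (Real.exp (-(x ^ 2 / (2 * p))) : ℝ)) (-(√(p - 1) / (2 * Real.pi * p)) * y) =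
    (√(2 * Real.pi * p) * Real.exp (-(y ^ 2 / (2 * q))) : ℝ) *
      ∑ k, c k * Complex.exp ((-(p * μ k ^ 2 / 2) + -(√(p - 1) * μ k) * y : ℝ) : ℂ) := by
  have hp0 : 0 < p - 1 := by linarith
  have hp : 0 < p := by linarith
  have hpi := Real.pi_pos
  have hpC : (p : ℂ) ≠ 0 := by exact_mod_cast hp.ne'
  have hp0C : (p : ℂ) - 1 ≠ 0 := by exact_mod_cast hp0.ne'
  have hpiC : (Real.pi : ℂ) ≠ 0 := by exact_mod_cast hpi.ne'
  set ω := √(p - 1) with hω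
  have hω2 : (ω : ℂ) ^ 2 = p - 1 := by
    have : ω ^ 2 = p - 1 := Real.sq_sqrt hp0.le
    exact_mod_cast this
  have hb : 0 < (((1 / (2 * p) : ℝ)) : ℂ).re := by rw [Complex.ofReal_re]; positivity
  have hterm : ∀ (k : κ) (x : ℝ), c k * (Complex.exp (Complex.I * (μ k + ω * y / p : ℝ) * x) *
      Complex.exp (-((1 / (2 * p) : ℝ) : ℂ) * x ^ 2)) =
      c k * Complex.exp ((μ k * x : ℝ) * Complex.I) * (Real.exp (-(x ^ 2 / (2 * p))) : ℝ) *
      Complex.exp (-(2 * Real.pi * Complex.I * x * (-(ω / (2 * Real.pi * p)) * y : ℝ))) := by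
    intro k x
    rw [Complex.ofReal_exp, mul_assoc (c k), mul_assoc (c k), ← Complex.exp_add,
      ← Complex.exp_add, ← Complex.exp_add]
    congr 2
    push_cast
    field_simp
    ring
  have hcont : ∀ k, Integrable fun x : ℝ =>
      c k * (Complex.exp (Complex.I * (μ k + ω * y / p : ℝ) * x) *
      Complex.exp (-((1 / (2 * p) : ℝ) : ℂ) * x ^ 2)) := by
    intro k
    refine Integrable.const_mul ?_ _
    have h := integrable_cexp_neg_mul_sq hb
    refine (h.bdd_mul (c := 1) (Continuous.aestronglyMeasurable (by fun_prop))
      (ae_of_all _ fun x => ?_))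
    have : Complex.I * (μ k + ω * y / p : ℝ) * x = (((μ k + ω * y / p) * x : ℝ) : ℂ) * Complex.I := by
      push_cast; ring
    rw [this, Complex.norm_exp_ofReal_mul_I]
  have h1 : lineFourier (fun x => (∑ k, c k * Complex.exp ((μ k * x : ℝ) * Complex.I)) *
      (Real.exp (-(x ^ 2 / (2 * p))) : ℝ)) (-(ω / (2 * Real.pi * p)) * y) =
      ∫ x : ℝ, ∑ k, c k * (Complex.exp (Complex.I * (μ k + ω * y / p : ℝ) * x) *
      Complex.exp (-((1 / (2 * p) : ℝ) : ℂ) * x ^ 2)) := by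
    rw [lineFourier]
    congr 1
    ext x
    simp only [hterm, Finset.sum_mul]
  rw [h1, integral_finsetSum _ (fun k _ => hcont k), Finset.mul_sum]
  refine Finset.sum_congr rfl fun k _ => ?_
  rw [integral_const_mul, fourierIntegral_gaussian hb]
  have h2 : ((Real.pi : ℂ) / ((1 / (2 * p) : ℝ) : ℂ)) ^ (1 / 2 : ℂ)
      = ((√(2 * Real.pi * p) : ℝ) : ℂ) := by
    rw [Real.sqrt_eq_rpow, Complex.ofReal_cpow (by positivity)]
    push_cast
    congr 1
    field_simp
  have h3 : Complex.exp (-((μ k + ω * y / p : ℝ) : ℂ) ^ 2 / (4 * ((1 / (2 * p) : ℝ) : ℂ))) =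
      Complex.exp ((-(y ^ 2 / (2 * q)) : ℝ) : ℂ) *
        Complex.exp ((-(p * μ k ^ 2 / 2) + -(ω * μ k) * y : ℝ) : ℂ) := by
    rw [← Complex.exp_add, hq]
    congr 1
    push_cast
    field_simp
    -- After completing the square, the coefficient of `y²` is `-ω²/(2p) = -(p - 1)/(2p) = -1/(2q)`.
    linear_combination (-4 * (y : ℂ) ^ 2) * hω2
  rw [h2, h3, Complex.ofReal_mul, Complex.ofReal_exp]
  ring

/-- A function satisfies the sharp Hausdorff–Young inequality with exponent `p`. -/
def SharpHausdorffYoung (p : ℝ) (h : ℝ → ℂ) : Prop :=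
  eLpNorm (lineFourier h) (ENNReal.ofReal (p / (p - 1))) volume ≤
    ENNReal.ofReal (becknerConst p) * eLpNorm h (ENNReal.ofReal p) volume

theorem lintegral_comp_mul_left {g : ℝ → ENNReal} (hg : Measurable g) {a : ℝ} (ha : a ≠ 0) :
    ∫⁻ x, g (a * x) = ENNReal.ofReal |a⁻¹| * ∫⁻ x, g x := by
  rw [← lintegral_map hg (measurable_const_mul a), Real.map_volume_mul_left ha,
    lintegral_smul_measure, smul_eq_mul]

theorem lintegral_gaussianReal_zero_one {g : ℝ → ENNReal} (hg : Measurable g) :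
    ∫⁻ x, g x ∂ProbabilityTheory.gaussianReal 0 1 =
      ENNReal.ofReal (√(2 * Real.pi))⁻¹ *
        ∫⁻ x, ENNReal.ofReal (Real.exp (-(x ^ 2 / 2))) * g x := by
  rw [ProbabilityTheory.gaussianReal_of_var_ne_zero _ one_ne_zero,
    lintegral_withDensity_eq_lintegral_mul _ (ProbabilityTheory.measurable_gaussianPDF 0 1) hg,
    ← lintegral_const_mul _ (by fun_prop)]
  refine lintegral_congr fun x => ?_
  rw [Pi.mul_apply, ← mul_assoc, ← ENNReal.ofReal_mul (by positivity),
    ProbabilityTheory.gaussianPDF, ProbabilityTheory.gaussianPDFReal]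
  congr 3
  · simp
  · simp [neg_div]

theorem integrable_trigPoly_mul_gaussian {p : ℝ} (hp : 0 < p) {κ : Type*} [Fintype κ] (c : κ → ℂ)
    (μ : κ → ℝ) :
    Integrable fun x : ℝ => (∑ k, c k * Complex.exp ((μ k * x : ℝ) * Complex.I)) *
      (Real.exp (-(x ^ 2 / (2 * p))) : ℝ) := by
  have h : Integrable fun x : ℝ => ((Real.exp (-(x ^ 2 / (2 * p))) : ℝ) : ℂ) := by
    refine Integrable.ofReal ?_
    refine (integrable_exp_neg_mul_sq (b := 1 / (2 * p)) (by positivity)).congr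
      (ae_of_all _ fun x => ?_)
    simp only
    congr 1
    ring
  refine h.bdd_mul (c := ∑ k, ‖c k‖) (Continuous.aestronglyMeasurable (by fun_prop))
    (ae_of_all _ fun x => norm_sum_le_of_le _ fun k _ => ?_)
  rw [norm_mul, Complex.norm_exp_ofReal_mul_I, mul_one]

/-- The Gaussian factor is chosen so that `|h|^p = e^{-x²/2} |f|^p`. After the dilation `ξ = -√(p-1)
y / (2πp)`, `|ĥ|^q` is a multiple of `e^{-y²/2} |F|^q`, with `F` the Mehler image of `f`. Gaussian
hypercontractivity is therefore exactly the claim. -/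
theorem sharpHausdorffYoung_trigPoly_gaussian {p : ℝ} (hp1 : 1 < p) (hp2 : p < 2)
    {κ : Type*} [Fintype κ] (c : κ → ℂ) (μ : κ → ℝ) :
    SharpHausdorffYoung p fun x : ℝ =>
      (∑ k, c k * Complex.exp ((μ k * x : ℝ) * Complex.I)) *
        (Real.exp (-(x ^ 2 / (2 * p))) : ℝ) := by
  have hp0 : 0 < p - 1 := by linarith
  have hp : 0 < p := by linarith
  have hpi := Real.pi_pos
  unfold SharpHausdorffYoung
  obtain ⟨q, hq⟩ : ∃ q, q = p / (p - 1) := ⟨_, rfl⟩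
  rw [← hq]
  have hq0 : 0 < q := by rw [hq]; positivity
  set f : ℝ → ℂ := fun x => ∑ k, c k * Complex.exp ((μ k * x : ℝ) * Complex.I) with hf
  set F : ℝ → ℂ := fun y => ∑ k, c k * Complex.exp
    ((-(p * μ k ^ 2 / 2) + -(√(p - 1) * μ k) * y : ℝ) : ℂ) with hF
  set h : ℝ → ℂ := fun x => f x * (Real.exp (-(x ^ 2 / (2 * p))) : ℝ) with hh
  have hfc : Continuous f := by fun_prop
  have hFc : Continuous F := by fun_prop
  have hhi : Integrable h := integrable_trigPoly_mul_gaussian hp c μ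
  have hhc := continuous_lineFourier hhi
  have key := gaussian_complex_hypercontractivity hp1 hp2 hq c μ
  have hlam : -(√(p - 1) / (2 * Real.pi * p)) ≠ 0 := by
    have : 0 < √(p - 1) := Real.sqrt_pos.2 hp0
    exact neg_ne_zero.2 (by positivity)
  have hM : ∀ y, ‖lineFourier h (-(√(p - 1) / (2 * Real.pi * p)) * y)‖ ^ q =
      √(2 * Real.pi * p) ^ q * (Real.exp (-(y ^ 2 / 2)) * ‖F y‖ ^ q) := by
    intro y
    rw [lineFourier_trigPoly_gaussian hp1 hq c μ y, norm_mul, Complex.norm_real, Real.norm_eq_abs,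
      abs_of_nonneg (by positivity), Real.mul_rpow (by positivity) (norm_nonneg _),
      Real.mul_rpow (by positivity) (by positivity), ← Real.exp_mul, mul_assoc]
    congr 3
    field_simp
  have hN : ∀ x, ‖h x‖ ^ p = Real.exp (-(x ^ 2 / 2)) * ‖f x‖ ^ p := by
    intro x
    rw [hh]
    simp only
    rw [norm_mul, Complex.norm_real, Real.norm_eq_abs, abs_of_nonneg (by positivity),
      Real.mul_rpow (norm_nonneg _) (by positivity), ← Real.exp_mul, mul_comm]
    congr 2
    field_simp
  set Iq := ∫⁻ ξ, ENNReal.ofReal (‖lineFourier h ξ‖ ^ q) with hIq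
  set Ip := ∫⁻ x, ENNReal.ofReal (‖h x‖ ^ p) with hIp
  have hmq : Measurable fun y => ENNReal.ofReal (‖F y‖ ^ q) :=
    (hFc.measurable.norm.pow_const q).ennreal_ofReal
  have hmp : Measurable fun y => ENNReal.ofReal (‖f y‖ ^ p) :=
    (hfc.measurable.norm.pow_const p).ennreal_ofReal
  have hL1 : ENNReal.ofReal |(-(√(p - 1) / (2 * Real.pi * p)))⁻¹| * Iq =
      ENNReal.ofReal (√(2 * Real.pi * p) ^ q) *
        ∫⁻ y, ENNReal.ofReal (Real.exp (-(y ^ 2 / 2))) * ENNReal.ofReal (‖F y‖ ^ q) := by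
    rw [hIq, ← lintegral_comp_mul_left (hhc.measurable.norm.pow_const q).ennreal_ofReal hlam,
      ← lintegral_const_mul _ (by fun_prop)]
    refine lintegral_congr fun y => ?_
    rw [hM, ENNReal.ofReal_mul (by positivity), ENNReal.ofReal_mul (by positivity)]
  have hR1 : ∫ x, ‖f x‖ ^ p ∂ProbabilityTheory.gaussianReal 0 1 =
      (ENNReal.ofReal (√(2 * Real.pi))⁻¹ * Ip).toReal := by
    rw [integral_eq_lintegral_of_nonneg_ae (ae_of_all _ fun x => by positivity)
      ((hfc.norm.measurable.pow_const p).aestronglyMeasurable),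
      lintegral_gaussianReal_zero_one hmp, hIp]
    congr 3
    ext x
    rw [hN, ENNReal.ofReal_mul (by positivity)]
  have hR2 : ENNReal.ofReal ((∫ x, ‖f x‖ ^ p ∂ProbabilityTheory.gaussianReal 0 1) ^ (q / p)) ≤
      (ENNReal.ofReal (√(2 * Real.pi))⁻¹ * Ip) ^ (q / p) := by
    rw [hR1, ← ENNReal.ofReal_rpow_of_nonneg ENNReal.toReal_nonneg (by positivity)]
    exact ENNReal.rpow_le_rpow ENNReal.ofReal_toReal_le (by positivity)
  rw [lintegral_gaussianReal_zero_one hmq] at key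
  have key2 := key.trans hR2
  have hsq : 0 < √(p - 1) := Real.sqrt_pos.2 hp0
  have hfin : Iq ≤ ENNReal.ofReal (becknerConst p ^ q) * Ip ^ (q / p) := by
    have hC : Iq = ENNReal.ofReal (√(2 * Real.pi) * (√(2 * Real.pi * p)) ^ q *
        (√(p - 1) / (2 * Real.pi * p))) * (ENNReal.ofReal (√(2 * Real.pi))⁻¹ *
        ∫⁻ y, ENNReal.ofReal (Real.exp (-(y ^ 2 / 2))) * ENNReal.ofReal (‖F y‖ ^ q)) := by
      rw [← mul_assoc, ← ENNReal.ofReal_mul (by positivity),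
        show √(2 * Real.pi) * (√(2 * Real.pi * p)) ^ q * (√(p - 1) / (2 * Real.pi * p)) *
          (√(2 * Real.pi))⁻¹ = (√(p - 1) / (2 * Real.pi * p)) * √(2 * Real.pi * p) ^ q by
          field_simp, ENNReal.ofReal_mul (by positivity), mul_assoc, ← hL1, ← mul_assoc,
        ← ENNReal.ofReal_mul (by positivity), abs_inv, abs_neg, abs_of_pos (by positivity),
        mul_inv_cancel₀ (by positivity), ENNReal.ofReal_one, one_mul]
    rw [hC, ← becknerConst_rpow hp1 hq,
      ENNReal.ofReal_mul (q := (√(2 * Real.pi))⁻¹ ^ (q / p)) (by positivity),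
      mul_assoc (ENNReal.ofReal _)]
    refine mul_le_mul' le_rfl ?_
    refine key2.trans (le_of_eq ?_)
    rw [ENNReal.mul_rpow_of_nonneg _ _ (by positivity),
      ENNReal.ofReal_rpow_of_nonneg (by positivity) (by positivity)]
  rw [eLpNorm_ofReal_eq _ hq0, eLpNorm_ofReal_eq _ hp]
  calc Iq ^ (1 / q) ≤ (ENNReal.ofReal (becknerConst p ^ q) * Ip ^ (q / p)) ^ (1 / q) :=
        ENNReal.rpow_le_rpow hfin (by positivity)
    _ = ENNReal.ofReal (becknerConst p) * Ip ^ (1 / p) := by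
        have hB := becknerConst_pos hp1
        rw [ENNReal.mul_rpow_of_nonneg _ _ (by positivity),
          ENNReal.ofReal_rpow_of_nonneg (by positivity) (by positivity), ← ENNReal.rpow_mul,
          ← Real.rpow_mul hB.le, show q * (1 / q) = 1 by field_simp, Real.rpow_one]
        congr 2
        field_simp

/-! ### Extension of sharp Hausdorff–Young to integrable functions. -/

/-- Extend `f` periodically from `[-m, m)`, continuously since it vanishes at both ends, and use
density of trigonometric polynomials on the circle. Periodicity makes the bound `M + δ` global,
which later supplies a dominating function. -/
theorem exists_trigPoly_approx {f : ℝ → ℂ} (hf : Continuous f) {m M : ℝ} (hm : 0 < m)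
    (hsupp : ∀ x, m ≤ |x| → f x = 0) (hM : ∀ x, ‖f x‖ ≤ M) {δ : ℝ} (hδ : 0 < δ) :
    ∃ (κ : Finset ℤ) (c : κ → ℂ) (μ : κ → ℝ),
      (∀ x : ℝ, ‖∑ k, c k * Complex.exp ((μ k * x : ℝ) * Complex.I)‖ ≤ M + δ) ∧
      ∀ x : ℝ, |x| < m → ‖∑ k, c k * Complex.exp ((μ k * x : ℝ) * Complex.I) - f x‖ ≤ δ := by
  have hT : Fact (0 < 2 * m) := ⟨by linarith⟩
  have hend : f (-m) = f (-m + 2 * m) := by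
    rw [hsupp (-m) (by rw [abs_neg, abs_of_pos hm]),
      hsupp (-m + 2 * m) (by rw [show -m + 2 * m = m by ring, abs_of_pos hm])]
  let F : C(AddCircle (2 * m), ℂ) :=
    ⟨AddCircle.liftIco (2 * m) (-m) f, AddCircle.liftIco_continuous hend hf.continuousOn⟩
  have hFM : ∀ z, ‖F z‖ ≤ M := fun z => hM _
  have hmem : F ∈ (Submodule.span ℂ (Set.range (@fourier (2 * m)))).topologicalClosure := by
    rw [span_fourier_closure_eq_top]; trivial
  obtain ⟨P, hP, hPF⟩ := Metric.mem_closure_iff.1 hmem δ hδ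
  obtain ⟨c, rfl⟩ := Finsupp.mem_span_range_iff_exists_finsupp.1 hP
  have hval : ∀ x : ℝ, (c.sum fun i a => a • (fourier i : C(AddCircle (2 * m), ℂ)))
      (x : AddCircle (2 * m)) = ∑ k : c.support,
        c k * Complex.exp ((2 * Real.pi * (k : ℤ) / (2 * m) * x : ℝ) * Complex.I) := by
    intro x
    rw [Finsupp.sum, ContinuousMap.sum_apply, ← Finset.sum_coe_sort]
    refine Finset.sum_congr rfl fun k _ => ?_
    rw [ContinuousMap.smul_apply, fourier_coe_apply, smul_eq_mul]
    congr 2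
    push_cast
    ring
  have hclose : ∀ z, ‖(c.sum fun i a => a • (fourier i : C(AddCircle (2 * m), ℂ))) z - F z‖
      ≤ δ := by
    intro z
    rw [dist_comm, dist_eq_norm] at hPF
    exact (ContinuousMap.norm_coe_le_norm _ z).trans hPF.le
  refine ⟨c.support, fun k => c k, fun k => 2 * Real.pi * (k : ℤ) / (2 * m), fun x => ?_,
    fun x hx => ?_⟩
  · rw [← hval]
    calc _ = ‖F x + ((c.sum fun i a => a • (fourier i : C(AddCircle (2 * m), ℂ))) x - F x)‖ := by
          rw [add_sub_cancel]
      _ ≤ M + δ := (norm_add_le _ _).trans (add_le_add (hFM _) (hclose _))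
  · rw [← hval]
    have hFx : F (x : AddCircle (2 * m)) = f x :=
      AddCircle.liftIco_coe_apply ⟨by linarith [(abs_lt.1 hx).1], by linarith [(abs_lt.1 hx).2]⟩
    rw [← hFx]
    exact hclose _

/-- Fatou on the Fourier side: the `L^q` norm is lower semicontinuous under pointwise convergence.
On the other side only upper bounds for the `L^p` norms have to converge. -/
theorem SharpHausdorffYoung.of_tendsto {p : ℝ} {h : ℝ → ℂ} {u : ℕ → ℝ → ℂ}
    (hu : ∀ n, SharpHausdorffYoung p (u n)) (hui : ∀ n, Integrable (u n))
    (hlim : ∀ ξ, Tendsto (fun n => lineFourier (u n) ξ) atTop (𝓝 (lineFourier h ξ)))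
    {N : ℕ → ENNReal} (hN : ∀ n, eLpNorm (u n) (ENNReal.ofReal p) volume ≤ N n)
    (hNlim : Tendsto N atTop (𝓝 (eLpNorm h (ENNReal.ofReal p) volume))) :
    SharpHausdorffYoung p h := by
  refine (Lp.eLpNorm_lim_le_liminf_eLpNorm
    (fun n => (continuous_lineFourier (hui n)).aestronglyMeasurable) _ (ae_of_all _ hlim)).trans ?_
  have h1 : Tendsto (fun n => ENNReal.ofReal (becknerConst p) * N n) atTop
      (𝓝 (ENNReal.ofReal (becknerConst p) * eLpNorm h (ENNReal.ofReal p) volume)) :=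
    ENNReal.Tendsto.const_mul hNlim (Or.inr ENNReal.ofReal_ne_top)
  rw [← h1.liminf_eq]
  exact liminf_le_liminf (Eventually.of_forall fun n => (hu n).trans (mul_le_mul' le_rfl (hN n)))

theorem tendsto_lineFourier_of_dominated {h : ℝ → ℂ} {u : ℕ → ℝ → ℂ} {b : ℝ → ℝ}
    (hum : ∀ n, AEStronglyMeasurable (u n) volume) (hb : Integrable b)
    (hub : ∀ n x, ‖u n x‖ ≤ b x) (hlim : ∀ x, Tendsto (fun n => u n x) atTop (𝓝 (h x))) (ξ : ℝ) :
    Tendsto (fun n => lineFourier (u n) ξ) atTop (𝓝 (lineFourier h ξ)) := by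
  refine tendsto_integral_of_dominated_convergence b (fun n => ?_) hb (fun n => ?_) ?_
  · exact (hum n).mul (Continuous.aestronglyMeasurable (by fun_prop))
  · exact ae_of_all _ fun x => by rw [norm_mul, norm_exp_neg_two_pi, mul_one]; exact hub n x
  · exact ae_of_all _ fun x => (hlim x).mul_const _

theorem tendsto_eLpNorm_of_dominated {h : ℝ → ℂ} {u : ℕ → ℝ → ℂ} {b : ℝ → ℝ} {p : ℝ}
    (hp : 0 < p) (hum : ∀ n, AEStronglyMeasurable (u n) volume)
    (hb : eLpNorm b (ENNReal.ofReal p) volume ≠ ⊤) (hub : ∀ n x, ‖u n x‖ ≤ b x)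
    (hlim : ∀ x, Tendsto (fun n => u n x) atTop (𝓝 (h x))) :
    Tendsto (fun n => eLpNorm (u n) (ENNReal.ofReal p) volume) atTop
      (𝓝 (eLpNorm h (ENNReal.ofReal p) volume)) := by
  simp only [eLpNorm_ofReal_eq _ hp] at hb ⊢
  refine (ENNReal.continuous_rpow_const.tendsto _).comp ?_
  refine tendsto_lintegral_of_dominated_convergence' (fun x => ENNReal.ofReal (‖b x‖ ^ p))
    (fun n => ((hum n).norm.aemeasurable.pow_const p).ennreal_ofReal) (fun n => ?_) ?_ ?_
  · refine ae_of_all _ fun x => ENNReal.ofReal_le_ofReal ?_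
    exact Real.rpow_le_rpow (norm_nonneg _) ((hub n x).trans (Real.le_norm_self _)) hp.le
  · intro htop
    rw [htop, ENNReal.top_rpow_of_pos (by positivity)] at hb
    exact hb rfl
  · refine ae_of_all _ fun x => ENNReal.tendsto_ofReal ?_
    exact ((hlim x).norm).rpow_const (Or.inr hp.le)

theorem sharpHausdorffYoung_of_hasCompactSupport {p : ℝ} (hp1 : 1 < p) (hp2 : p < 2)
    {h : ℝ → ℂ} (hc : Continuous h) (hs : HasCompactSupport h) : SharpHausdorffYoung p h := by
  have hp : 0 < p := by linarith
  -- Dividing by the Gaussian keeps compact support. Approximants of `f` on growing periods,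
  -- multiplied back by the Gaussian, converge to `h` under a fixed Gaussian majorant.
  set f : ℝ → ℂ := fun x => h x * (Real.exp (x ^ 2 / (2 * p)) : ℝ) with hf
  have hfc : Continuous f := by fun_prop
  have hfs : HasCompactSupport f := hs.mul_right
  obtain ⟨M, hM⟩ := hfs.exists_bound_of_continuous hfc
  obtain ⟨R, hR⟩ := hfs.isCompact.isBounded.subset_closedBall 0
  have hf0 : ∀ x, R < |x| → f x = 0 := by
    intro x hx
    by_contra hne
    have := hR (subset_tsupport f hne)
    simp only [Metric.mem_closedBall, dist_zero_right, Real.norm_eq_abs] at this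
    linarith
  have hex : ∀ n : ℕ, ∃ (κ : Finset ℤ) (c : κ → ℂ) (μ : κ → ℝ),
      (∀ x : ℝ, ‖∑ k, c k * Complex.exp ((μ k * x : ℝ) * Complex.I)‖ ≤ M + 1 / ((n : ℝ) + 1)) ∧
      ∀ x : ℝ, |x| < |R| + n + 1 →
        ‖∑ k, c k * Complex.exp ((μ k * x : ℝ) * Complex.I) - f x‖ ≤ 1 / ((n : ℝ) + 1) := by
    intro n
    refine exists_trigPoly_approx hfc (by positivity) (fun x hx => hf0 x ?_) hM (by positivity)
    have := le_abs_self R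
    have : (0 : ℝ) ≤ n := by positivity
    linarith
  choose κ c μ hbd happ using hex
  set g : ℕ → ℝ → ℂ := fun n x => ∑ k, c n k * Complex.exp ((μ n k * x : ℝ) * Complex.I) with hg
  have hglim : ∀ x, Tendsto (fun n => g n x) atTop (𝓝 (f x)) := by
    intro x
    rw [tendsto_iff_norm_sub_tendsto_zero]
    refine squeeze_zero' (Eventually.of_forall fun n => norm_nonneg _) ?_
      tendsto_one_div_add_atTop_nhds_zero_nat
    filter_upwards [tendsto_natCast_atTop_atTop.eventually (eventually_ge_atTop |x|)] with n hn
    exact happ n x (by have := abs_nonneg R; linarith)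
  have hgb : ∀ n x, ‖g n x‖ ≤ M + 1 := by
    intro n x
    refine (hbd n x).trans ?_
    have : 1 / ((n : ℝ) + 1) ≤ 1 := by
      rw [div_le_one (by positivity)]
      have : (0 : ℝ) ≤ n := by positivity
      linarith
    linarith
  set u : ℕ → ℝ → ℂ := fun n x => g n x * (Real.exp (-(x ^ 2 / (2 * p))) : ℝ) with hu
  set b : ℝ → ℝ := fun x => (M + 1) * Real.exp (-(x ^ 2 / (2 * p))) with hb
  have hub : ∀ n x, ‖u n x‖ ≤ b x := by
    intro n x
    rw [hu, hb]
    simp only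
    rw [norm_mul, Complex.norm_real, Real.norm_eq_abs, abs_of_nonneg (Real.exp_nonneg _)]
    exact mul_le_mul_of_nonneg_right (hgb n x) (Real.exp_nonneg _)
  have hlim : ∀ x, Tendsto (fun n => u n x) atTop (𝓝 (h x)) := by
    intro x
    have h1 := (hglim x).mul_const ((Real.exp (-(x ^ 2 / (2 * p))) : ℝ) : ℂ)
    have h2 : f x * ((Real.exp (-(x ^ 2 / (2 * p))) : ℝ) : ℂ) = h x := by
      rw [hf]
      simp only
      rw [mul_assoc, ← Complex.ofReal_mul, ← Real.exp_add, add_neg_cancel, Real.exp_zero,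
        Complex.ofReal_one, mul_one]
    rwa [h2] at h1
  have hui : ∀ n, Integrable (u n) := fun n => integrable_trigPoly_mul_gaussian hp (c n) (μ n)
  have hexpi : ∀ a : ℝ, 0 < a → Integrable fun x : ℝ => Real.exp (-(a * x ^ 2)) := by
    intro a ha
    simpa only [neg_mul] using integrable_exp_neg_mul_sq ha
  have hbi : Integrable b := by
    refine Integrable.const_mul ?_ _
    refine (hexpi (1 / (2 * p)) (by positivity)).congr (ae_of_all _ fun x => ?_)
    simp only
    congr 1
    ring
  have hbp : eLpNorm b (ENNReal.ofReal p) volume ≠ ⊤ := by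
    rw [eLpNorm_ofReal_eq _ hp]
    refine ENNReal.rpow_ne_top_of_nonneg (by positivity) (ne_of_lt ?_)
    have hi : Integrable fun x : ℝ => |M + 1| ^ p * Real.exp (-(1 / 2 * x ^ 2)) :=
      (hexpi (1 / 2) (by norm_num)).const_mul _
    have := hi.hasFiniteIntegral
    rw [hasFiniteIntegral_iff_ofReal (ae_of_all _ fun x => by positivity)] at this
    convert! this using 3 with x
    rw [hb]
    simp only
    rw [norm_mul, Real.norm_eq_abs, Real.norm_eq_abs, abs_of_nonneg (Real.exp_nonneg _),
      Real.mul_rpow (abs_nonneg _) (Real.exp_nonneg _), ← Real.exp_mul]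
    congr 2
    field_simp
  exact SharpHausdorffYoung.of_tendsto
    (fun n => sharpHausdorffYoung_trigPoly_gaussian hp1 hp2 (c n) (μ n)) hui
    (tendsto_lineFourier_of_dominated (fun n => (hui n).1) hbi hub hlim) (fun n => le_rfl)
    (tendsto_eLpNorm_of_dominated hp (fun n => (hui n).1) hbp hub hlim)

theorem norm_lineFourier_sub_le {g h : ℝ → ℂ} (hg : Integrable g) (hh : Integrable h) (ξ : ℝ) :
    ‖lineFourier g ξ - lineFourier h ξ‖ₑ ≤ eLpNorm (h - g) 1 volume := by
  rw [lineFourier, lineFourier, ← integral_sub (integrable_mul_exp_neg_two_pi hg ξ)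
    (integrable_mul_exp_neg_two_pi hh ξ), eLpNorm_one_eq_lintegral_enorm]
  refine (enorm_integral_le_lintegral_enorm _).trans (lintegral_mono fun x => ?_)
  rw [← sub_mul, enorm_mul, Pi.sub_apply, ← enorm_neg, neg_sub]
  have : ‖Complex.exp (-(2 * Real.pi * Complex.I * x * ξ))‖ₑ = 1 := by
    rw [← ofReal_norm, norm_exp_neg_two_pi, ENNReal.ofReal_one]
  rw [this, mul_one]

/-- Approximate in `L^p` by continuous functions and multiply by a cutoff that fixes `h`. All
supports then lie in one ball, where `L^p` convergence implies `L¹` convergence and hence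
convergence of the Fourier transforms. -/
theorem sharpHausdorffYoung_of_support_subset {p : ℝ} (hp1 : 1 < p) (hp2 : p < 2)
    {h : ℝ → ℂ} (hh : MemLp h (ENNReal.ofReal p) volume) (hi : Integrable h) {m : ℕ}
    (hs : ∀ x, (m : ℝ) < |x| → h x = 0) : SharpHausdorffYoung p h := by
  have hp : 0 < p := by linarith
  have hex : ∀ n : ℕ, ∃ g : ℝ → ℂ, HasCompactSupport g ∧
      eLpNorm (h - g) (ENNReal.ofReal p) volume ≤ ((n : ENNReal) + 1)⁻¹ ∧ Continuous g ∧
      MemLp g (ENNReal.ofReal p) volume := fun n =>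
    hh.exists_hasCompactSupport_eLpNorm_sub_le ENNReal.ofReal_ne_top
      (ENNReal.inv_ne_zero.2 (by finiteness))
  choose g hgs hgn hgc hgp using hex
  set u : ℕ → ℝ → ℂ := fun n x => cutoff m x * g n x with hu
  have huc : ∀ n, Continuous (u n) := fun n =>
    (Complex.continuous_ofReal.comp (continuous_cutoff m)).mul (hgc n)
  have hus : ∀ n, HasCompactSupport (u n) := fun n => (hgs n).mul_left
  have hui : ∀ n, Integrable (u n) := fun n => (huc n).integrable_of_hasCompactSupport (hus n)
  have hsub : ∀ n x, (h - u n) x = cutoff m x * (h - g n) x := by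
    intro n x
    rw [Pi.sub_apply, Pi.sub_apply, mul_sub, hu]
    simp only
    by_cases hx : |x| ≤ m
    · rw [cutoff_eq_one hx, Complex.ofReal_one, one_mul (h x)]
    · rw [hs x (not_le.1 hx), mul_zero]
  have hdist : ∀ n, eLpNorm (h - u n) (ENNReal.ofReal p) volume ≤ ((n : ENNReal) + 1)⁻¹ := by
    intro n
    refine (eLpNorm_mono fun x => ?_).trans (hgn n)
    rw [hsub, norm_mul, Complex.norm_real, Real.norm_eq_abs, abs_of_nonneg (cutoff_nonneg m x)]
    exact mul_le_of_le_one_left (norm_nonneg _) (cutoff_le_one m x)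
  set K := Metric.closedBall (0 : ℝ) (m + 1) with hK
  have hdist1 : ∀ n, eLpNorm (h - u n) 1 volume ≤
      ((n : ENNReal) + 1)⁻¹ * volume K ^ (1 / (1 : ENNReal).toReal - 1 / (ENNReal.ofReal p).toReal) := by
    intro n
    have hsupp : Function.support (h - u n) ⊆ K := by
      intro x hx
      by_contra hxK
      exact hx (by rw [hsub, cutoff_eq_zero hxK, Complex.ofReal_zero, zero_mul])
    rw [← eLpNorm_restrict_eq_of_support_subset hsupp]
    refine (eLpNorm_le_eLpNorm_mul_rpow_measure_univ (q := ENNReal.ofReal p) ?_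
      (hi.1.sub (hui n).1).restrict).trans ?_
    · rw [← ENNReal.ofReal_one]
      exact ENNReal.ofReal_le_ofReal hp1.le
    · rw [eLpNorm_restrict_eq_of_support_subset hsupp, Measure.restrict_apply_univ]
      exact mul_le_mul' (hdist n) le_rfl
  have hinv : Tendsto (fun n : ℕ => ((n : ENNReal) + 1)⁻¹) atTop (𝓝 0) := by
    have := (tendsto_add_atTop_iff_nat 1).2 ENNReal.tendsto_inv_nat_nhds_zero
    simpa using this
  refine SharpHausdorffYoung.of_tendsto
    (N := fun n => eLpNorm h (ENNReal.ofReal p) volume + ((n : ENNReal) + 1)⁻¹)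
    (fun n => sharpHausdorffYoung_of_hasCompactSupport hp1 hp2 (huc n) (hus n)) hui ?_ ?_ ?_
  · intro ξ
    rw [tendsto_iff_edist_tendsto_0]
    have hz : Tendsto (fun n : ℕ => ((n : ENNReal) + 1)⁻¹ *
        volume K ^ (1 / (1 : ENNReal).toReal - 1 / (ENNReal.ofReal p).toReal)) atTop (𝓝 0) := by
      have := ENNReal.Tendsto.mul_const
        (b := volume K ^ (1 / (1 : ENNReal).toReal - 1 / (ENNReal.ofReal p).toReal)) hinv
        (Or.inr ?_)
      · rwa [zero_mul] at this
      · refine ENNReal.rpow_ne_top_of_nonneg ?_ measure_closedBall_lt_top.ne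
        rw [ENNReal.toReal_ofReal hp.le, ENNReal.toReal_one, sub_nonneg]
        exact one_div_le_one_div_of_le one_pos hp1.le
    refine tendsto_of_tendsto_of_tendsto_of_le_of_le tendsto_const_nhds hz (fun _ => zero_le)
      fun n => ?_
    rw [edist_eq_enorm_sub]
    exact (norm_lineFourier_sub_le (hui n) hi ξ).trans (hdist1 n)
  · intro n
    have : u n = h - (h - u n) := by rw [sub_sub_cancel]
    rw [this]
    refine (eLpNorm_sub_le hi.1 (hi.1.sub (hui n).1) ?_).trans (add_le_add le_rfl (hdist n))
    rw [← ENNReal.ofReal_one]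
    exact ENNReal.ofReal_le_ofReal hp1.le
  · simpa using tendsto_const_nhds.add hinv

/-- The **Babenko–Beckner inequality**: the sharp Hausdorff–Young inequality on the line. -/
theorem sharpHausdorffYoung {p : ℝ} (hp1 : 1 < p) (hp2 : p < 2) {h : ℝ → ℂ} (hi : Integrable h) :
    SharpHausdorffYoung p h := by
  have hp : 0 < p := by linarith
  by_cases htop : eLpNorm h (ENNReal.ofReal p) volume = ⊤
  · unfold SharpHausdorffYoung
    rw [htop, ENNReal.mul_top (by simpa using becknerConst_pos hp1)]
    exact le_top
  have hh : MemLp h (ENNReal.ofReal p) volume := ⟨hi.1, lt_top_iff_ne_top.2 htop⟩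
  set u : ℕ → ℝ → ℂ := fun n => (Metric.closedBall (0 : ℝ) n).indicator h with hu
  have hle : ∀ n x, ‖u n x‖ ≤ ‖h x‖ := fun n x => norm_indicator_le_norm_self h x
  have hui : ∀ n, Integrable (u n) := fun n => hi.indicator measurableSet_closedBall
  refine SharpHausdorffYoung.of_tendsto (u := u)
    (N := fun _ => eLpNorm h (ENNReal.ofReal p) volume) (fun n => ?_) hui ?_ ?_
    tendsto_const_nhds
  · refine sharpHausdorffYoung_of_support_subset hp1 hp2 (m := n)
      (hh.indicator measurableSet_closedBall) (hui n) fun x hx => ?_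
    exact Set.indicator_of_notMem (by simpa using hx) h
  · refine tendsto_lineFourier_of_dominated (fun n => (hui n).1) hi.norm hle fun x => ?_
    refine tendsto_const_nhds.congr' ?_
    filter_upwards [tendsto_natCast_atTop_atTop.eventually (eventually_ge_atTop |x|)] with n hn
    exact (Set.indicator_of_mem (by simpa using hn) h).symm
  · exact fun n => eLpNorm_mono (hle n)

/-! ### Absolutely continuous functions and primitives from `-∞`. -/

theorem AbsolutelyContinuousOnInterval.of_dist_le {X Y : Type*} [PseudoMetricSpace X]
    [PseudoMetricSpace Y] {g : ℝ → X} {h : ℝ → Y} {a b : ℝ}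
    (hh : AbsolutelyContinuousOnInterval h a b)
    (hle : ∀ x ∈ Set.uIcc a b, ∀ y ∈ Set.uIcc a b, dist (g x) (g y) ≤ dist (h x) (h y)) :
    AbsolutelyContinuousOnInterval g a b := by
  rw [absolutelyContinuousOnInterval_iff] at hh ⊢
  intro ε hε
  obtain ⟨δ, hδ, H⟩ := hh ε hε
  refine ⟨δ, hδ, fun E hE hlen => lt_of_le_of_lt (Finset.sum_le_sum fun i hi => ?_) (H E hE hlen)⟩
  exact hle _ (hE.1 i hi).1 _ (hE.1 i hi).2

theorem AbsolutelyContinuousOnInterval.conj {g : ℝ → ℂ} {a b : ℝ}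
    (hg : AbsolutelyContinuousOnInterval g a b) :
    AbsolutelyContinuousOnInterval (fun x => starRingEnd ℂ (g x)) a b :=
  hg.of_dist_le fun x _ y _ => (Complex.dist_conj_conj (g x) (g y)).le

theorem AbsolutelyContinuousOnInterval.cmul {g h : ℝ → ℂ} {a b : ℝ}
    (hg : AbsolutelyContinuousOnInterval g a b) (hh : AbsolutelyContinuousOnInterval h a b) :
    AbsolutelyContinuousOnInterval (fun x => g x * h x) a b :=
  hg.smul hh

/-- The source of the exponential-mass identity and the conservation laws below: the derivative
vanishes only almost everywhere, absolute continuity makes the function constant, and the constant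
is read off at `-∞`. -/
theorem eq_of_absolutelyContinuous_of_deriv_eq_zero {E : Type*} [NormedAddCommGroup E]
    [NormedSpace ℝ E] {g : ℝ → E} (hg : ∀ a b, AbsolutelyContinuousOnInterval g a b)
    (hd : ∀ᵐ x, HasDerivAt g 0 x) {c : E} (hc : Tendsto g atBot (𝓝 c)) (x : ℝ) : g x = c := by
  have h : ∀ y, g y = g x := by
    intro y
    obtain ⟨C, hC⟩ := (hg x y).const_of_ae_hasDerivAt_zero (hd.mono fun z hz _ => hz)
    rw [hC x Set.left_mem_uIcc, hC y Set.right_mem_uIcc]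
  exact tendsto_nhds_unique (tendsto_const_nhds.congr fun y => (h y).symm) hc

theorem setIntegral_Iic_sub {E : Type*} [NormedAddCommGroup E] [NormedSpace ℝ E]
    {g : ℝ → E} (hg : Integrable g) (x y : ℝ) :
    (∫ t in Set.Iic y, g t) - ∫ t in Set.Iic x, g t = ∫ t in x..y, g t :=
  intervalIntegral.integral_Iic_sub_Iic hg.integrableOn hg.integrableOn

theorem absolutelyContinuousOnInterval_setIntegral_Iic {E : Type*} [NormedAddCommGroup E]
    [NormedSpace ℝ E] {g : ℝ → E} (hg : Integrable g) (a b : ℝ) :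
    AbsolutelyContinuousOnInterval (fun x => ∫ t in Set.Iic x, g t) a b := by
  have h := (hg.norm.intervalIntegrable (a := a) (b := b)).absolutelyContinuousOnInterval_intervalIntegral
    (c := a) Set.left_mem_uIcc
  refine h.of_dist_le fun x _ y _ => ?_
  have e : (∫ t in a..x, ‖g t‖) - ∫ t in a..y, ‖g t‖ = ∫ t in y..x, ‖g t‖ :=
    intervalIntegral.integral_interval_sub_left hg.norm.intervalIntegrable
      hg.norm.intervalIntegrable
  rw [dist_eq_norm, dist_eq_norm, e, setIntegral_Iic_sub hg, Real.norm_eq_abs]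
  exact intervalIntegral.norm_integral_le_abs_integral_norm

theorem ae_hasDerivAt_setIntegral_Iic {E : Type*} [NormedAddCommGroup E]
    [NormedSpace ℝ E] [CompleteSpace E] {g : ℝ → E} (hg : Integrable g) :
    ∀ᵐ x, HasDerivAt (fun x => ∫ t in Set.Iic x, g t) (g x) x := by
  filter_upwards [LocallyIntegrable.ae_hasDerivAt_integral hg.locallyIntegrable] with x hx
  refine ((hx 0).const_add (∫ t in Set.Iic (0 : ℝ), g t)).congr_of_eventuallyEq
    (Eventually.of_forall fun y => ?_)
  simp only
  rw [← setIntegral_Iic_sub hg 0 y, add_sub_cancel]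

theorem tendsto_setIntegral_Iic_atBot {E : Type*} [NormedAddCommGroup E] [NormedSpace ℝ E]
    (g : ℝ → E) : Tendsto (fun x => ∫ t in Set.Iic x, g t) atBot (𝓝 0) :=
  tendsto_integral_Iic_zero tendsto_id

theorem tendsto_setIntegral_Iic_atTop {E : Type*} [NormedAddCommGroup E] [NormedSpace ℝ E]
    {g : ℝ → E} (hg : Integrable g) :
    Tendsto (fun x => ∫ t in Set.Iic x, g t) atTop (𝓝 (∫ t, g t)) :=
  (aecover_Iic tendsto_id).integral_tendsto_of_countably_generated hg

/-! ### Cumulative mass and Grönwall. -/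

/-- The mass of `f` on `(-∞, x]`. -/
noncomputable def cumMass (f : ℝ → ℂ) (x : ℝ) : ℝ := ∫ t in Set.Iic x, ‖f t‖

theorem cumMass_nonneg (f : ℝ → ℂ) (x : ℝ) : 0 ≤ cumMass f x :=
  integral_nonneg fun _ => norm_nonneg _

theorem cumMass_le {f : ℝ → ℂ} (hf : Integrable f) (x : ℝ) : cumMass f x ≤ ∫ t, ‖f t‖ :=
  setIntegral_le_integral hf.norm (ae_of_all _ fun _ => norm_nonneg _)

theorem continuous_cumMass {f : ℝ → ℂ} (hf : Integrable f) : Continuous (cumMass f) := by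
  refine continuous_iff_continuousAt.2 fun x => ?_
  exact (absolutelyContinuousOnInterval_setIntegral_Iic hf.norm (x - 1) (x + 1)).continuousOn.continuousAt
    (by rw [Set.uIcc_of_le (by linarith)]; exact Icc_mem_nhds (by linarith) (by linarith))

theorem integrable_norm_mul_exp_cumMass {f : ℝ → ℂ} (hf : Integrable f) (c : ℝ) :
    Integrable fun t => ‖f t‖ * Real.exp (c * cumMass f t) := by
  have hcont := continuous_cumMass hf
  refine hf.norm.mul_bdd (c := Real.exp (|c| * ∫ t, ‖f t‖))
    (Continuous.aestronglyMeasurable (by fun_prop)) (ae_of_all _ fun t => ?_)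
  rw [Real.norm_eq_abs, Real.abs_exp]
  refine Real.exp_le_exp.2 (mul_le_mul (le_abs_self c) (cumMass_le hf t) (cumMass_nonneg f t)
    (abs_nonneg c))

theorem mul_setIntegral_norm_mul_exp_cumMass {f : ℝ → ℂ} (hf : Integrable f) (c : ℝ) (x : ℝ) :
    c * ∫ t in Set.Iic x, ‖f t‖ * Real.exp (c * cumMass f t) = Real.exp (c * cumMass f x) - 1 := by
  have hInt := integrable_norm_mul_exp_cumMass hf c
  have hAC : ∀ a b, AbsolutelyContinuousOnInterval (fun x => Real.exp (c * cumMass f x)) a b := by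
    intro a b
    -- A Lipschitz constant of `s ↦ exp (c s)` on the bounded range of the cumulative mass; it makes
    -- the composition absolutely continuous.
    set L := |c| * Real.exp (|c| * ∫ t, ‖f t‖)
    have h1 : AbsolutelyContinuousOnInterval (fun x => L * cumMass f x) a b :=
      (absolutelyContinuousOnInterval_setIntegral_Iic hf.norm a b).const_mul L
    refine h1.of_dist_le fun x _ y _ => ?_
    have hconv : Convex ℝ (Set.Icc 0 (∫ t, ‖f t‖)) := convex_Icc _ _
    have := hconv.norm_image_sub_le_of_norm_hasDerivWithin_le
      (f := fun s => Real.exp (c * s)) (f' := fun s => Real.exp (c * s) * c) (C := L)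
      (x := cumMass f y) (y := cumMass f x) (fun s hs => by
        have h2 : HasDerivAt (fun s : ℝ => c * s) (c * 1) s := (hasDerivAt_id s).const_mul c
        simpa using h2.exp.hasDerivWithinAt)
      (fun s hs => by
        rw [norm_mul, Real.norm_eq_abs, Real.norm_eq_abs, Real.abs_exp, mul_comm]
        refine mul_le_mul_of_nonneg_left (Real.exp_le_exp.2 ?_) (abs_nonneg c)
        exact mul_le_mul (le_abs_self c) hs.2 hs.1 (abs_nonneg c))
      ⟨cumMass_nonneg f y, cumMass_le hf y⟩ ⟨cumMass_nonneg f x, cumMass_le hf x⟩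
    have hL : 0 ≤ L := mul_nonneg (abs_nonneg c) (Real.exp_nonneg _)
    rw [dist_eq_norm, dist_eq_norm, ← mul_sub, norm_mul, Real.norm_of_nonneg hL]
    exact this
  have h0 := eq_of_absolutelyContinuous_of_deriv_eq_zero
    (g := fun x => Real.exp (c * cumMass f x) -
      c * ∫ t in Set.Iic x, ‖f t‖ * Real.exp (c * cumMass f t)) (c := 1)
    (fun a b => (hAC a b).sub
      ((absolutelyContinuousOnInterval_setIntegral_Iic hInt a b).const_mul c)) ?_ ?_ x
  · linarith
  · filter_upwards [ae_hasDerivAt_setIntegral_Iic hf.norm, ae_hasDerivAt_setIntegral_Iic hInt]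
      with x h1 h2
    have h3 : HasDerivAt (fun x => Real.exp (c * cumMass f x))
        (Real.exp (c * cumMass f x) * (c * ‖f x‖)) x := (h1.const_mul c).exp
    exact (h3.sub (h2.const_mul c)).congr_deriv (by ring)
  · have h1 := (tendsto_setIntegral_Iic_atBot fun t => ‖f t‖).const_mul c
    have h2 := (Real.continuous_exp.tendsto _).comp h1
    have h3 := h2.sub ((tendsto_setIntegral_Iic_atBot fun t =>
      ‖f t‖ * Real.exp (c * cumMass f t)).const_mul c)
    simpa [Function.comp_def, cumMass] using h3

theorem integral_norm_mul_exp_cumMass {f : ℝ → ℂ} (hf : Integrable f) :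
    ∫ t, ‖f t‖ * Real.exp (cumMass f t) = Real.exp (∫ t, ‖f t‖) - 1 := by
  have hInt := integrable_norm_mul_exp_cumMass hf 1
  simp only [one_mul] at hInt
  have h1 := tendsto_setIntegral_Iic_atTop hInt
  have h2 := ((Real.continuous_exp.tendsto _).comp (tendsto_setIntegral_Iic_atTop hf.norm)).sub_const 1
  refine tendsto_nhds_unique h1 (h2.congr fun x => ?_)
  have := mul_setIntegral_norm_mul_exp_cumMass hf 1 x
  simp only [one_mul] at this
  rw [this]
  rfl

/-- A Grönwall inequality from `-∞`. -/
theorem le_mul_exp_cumMass {f : ℝ → ℂ} (hf : Integrable f) {g : ℝ → ℝ} (hg : Continuous g)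
    (hg0 : ∀ x, 0 ≤ g x) {C c : ℝ} (hgC : ∀ x, g x ≤ C) (hc : 0 ≤ c)
    (hle : ∀ x, g x ≤ c + ∫ t in Set.Iic x, ‖f t‖ * g t) (x : ℝ) :
    g x ≤ c * Real.exp (cumMass f x) := by
  have hgi : Integrable fun t => ‖f t‖ * g t :=
    hf.norm.mul_bdd (c := C) hg.aestronglyMeasurable
      (ae_of_all _ fun t => by rw [Real.norm_of_nonneg (hg0 t)]; exact hgC t)
  -- With `M = sup g exp (-l · cumMass)`, the hypothesis yields `M ≤ max c (M / l)`. As `l > 1`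
  -- makes `M / l < M` when `M > c ≥ 0`, this forces `M ≤ c`; finally `l → 1`.
  have key : ∀ l : ℝ, 1 < l → g x ≤ c * Real.exp (l * cumMass f x) := by
    intro l hl
    set w : ℝ → ℝ := fun t => g t * Real.exp (-(l * cumMass f t)) with hw
    have hexp : ∀ t, Real.exp (-(l * cumMass f t)) ≤ 1 := fun t =>
      Real.exp_le_one_iff.2 (by have := cumMass_nonneg f t; nlinarith)
    have hbdd : BddAbove (Set.range w) := by
      refine ⟨C, ?_⟩
      rintro _ ⟨t, rfl⟩
      exact (mul_le_of_le_one_right (hg0 t) (hexp t)).trans (hgC t)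
    set M := ⨆ t, w t with hM
    have hwM : ∀ t, w t ≤ M := fun t => le_ciSup hbdd t
    have hM0 : 0 ≤ M := (mul_nonneg (hg0 x) (Real.exp_nonneg _)).trans (hwM x)
    have hgw : ∀ t, g t = w t * Real.exp (l * cumMass f t) := by
      intro t
      rw [hw]
      simp only
      rw [mul_assoc, ← Real.exp_add, neg_add_cancel, Real.exp_zero, mul_one]
    have hstep : ∀ y, w y ≤ max c (M / l) := by
      intro y
      have h1 : ∫ t in Set.Iic y, ‖f t‖ * g t ≤
          M / l * (Real.exp (l * cumMass f y) - 1) := by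
        rw [← mul_setIntegral_norm_mul_exp_cumMass hf l y, ← mul_assoc,
          div_mul_cancel₀ _ (by linarith), ← integral_const_mul]
        refine setIntegral_mono hgi.integrableOn
          ((integrable_norm_mul_exp_cumMass hf l).const_mul M).integrableOn fun t => ?_
        simp only
        rw [hgw t, mul_left_comm M]
        exact mul_le_mul_of_nonneg_left (mul_le_mul_of_nonneg_right (hwM t) (Real.exp_nonneg _))
          (norm_nonneg _)
      have h2 := (hle y).trans (add_le_add le_rfl h1)
      have hE : 1 ≤ Real.exp (l * cumMass f y) :=
        Real.one_le_exp (mul_nonneg (by linarith) (cumMass_nonneg f y))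
      rw [hgw y] at h2
      have h3 : c + M / l * (Real.exp (l * cumMass f y) - 1) ≤
          max c (M / l) * Real.exp (l * cumMass f y) := by
        nlinarith [le_max_left c (M / l), mul_le_mul_of_nonneg_right (le_max_right c (M / l))
          (sub_nonneg.2 hE)]
      exact le_of_mul_le_mul_right (h2.trans h3) (Real.exp_pos _)
    have hMle : M ≤ max c (M / l) := ciSup_le hstep
    have hMc : M ≤ c := by
      by_contra hlt
      push Not at hlt
      have h1 : M / l < M := div_lt_self (lt_of_le_of_lt hc hlt) hl
      exact absurd hMle (not_le.2 (max_lt hlt h1))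
    rw [hgw x]
    exact mul_le_mul_of_nonneg_right ((hwM x).trans hMc) (Real.exp_nonneg _)
  have hcont : Continuous fun l : ℝ => c * Real.exp (l * cumMass f x) := by fun_prop
  have hlim : Tendsto (fun l : ℝ => c * Real.exp (l * cumMass f x)) (𝓝[>] 1)
      (𝓝 (c * Real.exp (1 * cumMass f x))) := (hcont.tendsto 1).mono_left nhdsWithin_le_nhds
  rw [one_mul] at hlim
  exact ge_of_tendsto hlim (eventually_nhdsWithin_of_forall fun l hl => key l hl)

/-! ### Construction of the scattering solution. -/

theorem continuous_setIntegral_Iic_param {E : Type*} [NormedAddCommGroup E] [NormedSpace ℝ E]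
    {H : ℝ → ℝ → E} {b : ℝ → ℝ} (hb : Integrable b)
    (hm : ∀ ξ, AEStronglyMeasurable (fun y => H y ξ) volume) (hbd : ∀ y ξ, ‖H y ξ‖ ≤ b y)
    (hc : ∀ y, Continuous (H y)) :
    Continuous fun z : ℝ × ℝ => ∫ y in Set.Iic z.1, H y z.2 := by
  simp only [← integral_indicator measurableSet_Iic]
  refine continuous_iff_continuousAt.2 fun z₀ => ?_
  refine continuousAt_of_dominated (bound := b) ?_ ?_ hb ?_
  · exact Eventually.of_forall fun z => (hm z.2).indicator measurableSet_Iic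
  · exact Eventually.of_forall fun z => ae_of_all _ fun y =>
      (norm_indicator_le_norm_self _ _).trans (hbd y z.2)
  · have hne : ∀ᵐ y : ℝ, y ≠ z₀.1 := by
      simp [ae_iff]
    filter_upwards [hne] with y hy
    have hcont : ContinuousAt (fun z : ℝ × ℝ => H y z.2) z₀ :=
      ((hc y).comp continuous_snd).continuousAt
    rcases lt_or_gt_of_ne hy with h | h
    · refine hcont.congr ?_
      filter_upwards [(continuous_fst.tendsto z₀).eventually (lt_mem_nhds h)] with z hz
      exact (Set.indicator_of_mem (show y ∈ Set.Iic z.1 from hz.le) fun y => H y z.2).symm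
    · refine (continuousAt_const (y := (0 : E))).congr ?_
      filter_upwards [(continuous_fst.tendsto z₀).eventually (gt_mem_nhds h)] with z hz
      exact (Set.indicator_of_notMem (show y ∉ Set.Iic z.1 from not_le.2 hz)
        fun y => H y z.2).symm

/-- The right-hand side of the scattering system as a function of the unknown pair. -/
noncomputable def scatterField (f : ℝ → ℂ) (ξ x : ℝ) (v : ℂ × ℂ) : ℂ × ℂ :=
  (starRingEnd ℂ (f x) * Complex.exp (2 * Real.pi * Complex.I * x * ξ) * v.2,
    f x * Complex.exp (-(2 * Real.pi * Complex.I * x * ξ)) * v.1)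

theorem norm_scatterField_le (f : ℝ → ℂ) (ξ x : ℝ) (v : ℂ × ℂ) :
    ‖scatterField f ξ x v‖ ≤ ‖f x‖ * ‖v‖ := by
  rw [scatterField, Prod.norm_def]
  refine max_le ?_ ?_
  · simp only
    rw [norm_mul, norm_mul, RCLike.norm_conj, norm_exp_two_pi, mul_one]
    exact mul_le_mul_of_nonneg_left (norm_snd_le v) (norm_nonneg _)
  · simp only
    rw [norm_mul, norm_mul, norm_exp_neg_two_pi, mul_one]
    exact mul_le_mul_of_nonneg_left (norm_fst_le v) (norm_nonneg _)

theorem scatterField_sub (f : ℝ → ℂ) (ξ x : ℝ) (v w : ℂ × ℂ) :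
    scatterField f ξ x (v - w) = scatterField f ξ x v - scatterField f ξ x w := by
  ext <;> simp [scatterField, mul_sub]

theorem continuous_scatterField_param (f : ℝ → ℂ) (x : ℝ) {v : ℝ → ℂ × ℂ} (hv : Continuous v) :
    Continuous fun ξ => scatterField f ξ x (v ξ) := by
  unfold scatterField
  fun_prop

theorem aestronglyMeasurable_scatterField {f : ℝ → ℂ} (hf : Integrable f) (ξ : ℝ)
    {v : ℝ → ℂ × ℂ} (hv : Continuous v) :
    AEStronglyMeasurable (fun x => scatterField f ξ x (v x)) volume := by
  unfold scatterField
  refine AEStronglyMeasurable.prodMk ?_ ?_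
  · exact ((Complex.continuous_conj.comp_aestronglyMeasurable hf.1).mul
      (Continuous.aestronglyMeasurable (by fun_prop))).mul
      (Continuous.aestronglyMeasurable (by fun_prop))
  · exact (hf.1.mul (Continuous.aestronglyMeasurable (by fun_prop))).mul
      (Continuous.aestronglyMeasurable (by fun_prop))

theorem integrable_scatterField {f : ℝ → ℂ} (hf : Integrable f) (ξ : ℝ) {v : ℝ → ℂ × ℂ}
    (hv : Continuous v) {C : ℝ} (hC : ∀ x, ‖v x‖ ≤ C) :
    Integrable fun x => scatterField f ξ x (v x) := by
  refine (hf.norm.mul_const C).mono' (aestronglyMeasurable_scatterField hf ξ hv)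
    (ae_of_all _ fun x => (norm_scatterField_le f ξ x (v x)).trans ?_)
  exact mul_le_mul_of_nonneg_left (hC x) (norm_nonneg _)

theorem continuous_setIntegral_scatterField {f : ℝ → ℂ} (hf : Integrable f)
    {v : ℝ × ℝ → ℂ × ℂ} (hv : Continuous v) {C : ℝ} (hC : ∀ z, ‖v z‖ ≤ C) :
    Continuous fun z : ℝ × ℝ => ∫ y in Set.Iic z.1, scatterField f z.2 y (v (y, z.2)) := by
  refine continuous_setIntegral_Iic_param (H := fun y ξ => scatterField f ξ y (v (y, ξ)))
    (hf.norm.mul_const C) (fun ξ => aestronglyMeasurable_scatterField hf ξ (by fun_prop))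
    (fun y ξ => (norm_scatterField_le f ξ y _).trans ?_)
    (fun y => continuous_scatterField_param f y (by fun_prop))
  exact mul_le_mul_of_nonneg_left (hC _) (norm_nonneg _)

/-- The contraction estimate: `∫ ‖f‖ exp (2 · cumMass)` up to `x` is at most half of `exp (2 ·
cumMass f x)`, so the weight `exp (2 · cumMass)` gains a factor `1 / 2` whatever the size of `‖f‖₁`.
-/
theorem norm_setIntegral_scatterField_le {f : ℝ → ℂ} (hf : Integrable f) (ξ x : ℝ)
    {w : ℝ → ℂ × ℂ} {C : ℝ} (hC : ∀ y, ‖w y‖ ≤ C * Real.exp (2 * cumMass f y)) (hC0 : 0 ≤ C) :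
    ‖∫ y in Set.Iic x, scatterField f ξ y (w y)‖ ≤ C / 2 * Real.exp (2 * cumMass f x) := by
  have h1 : ‖∫ y in Set.Iic x, scatterField f ξ y (w y)‖ ≤
      ∫ y in Set.Iic x, C * (‖f y‖ * Real.exp (2 * cumMass f y)) := by
    refine norm_integral_le_of_norm_le
      ((integrable_norm_mul_exp_cumMass hf 2).const_mul C).integrableOn
      (ae_of_all _ fun y => (norm_scatterField_le f ξ y _).trans ?_)
    rw [mul_left_comm]
    exact mul_le_mul_of_nonneg_left (hC y) (norm_nonneg _)
  refine h1.trans ?_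
  rw [integral_const_mul]
  have h2 := mul_setIntegral_norm_mul_exp_cumMass hf 2 x
  nlinarith

/-- Banach's fixed point theorem for the integral equation, in bounded continuous functions of the
pair `(x, ξ)`. Treating `ξ` as a variable gives joint continuity at once. -/
theorem exists_scattering_family {f : ℝ → ℂ} (hf : Integrable f) :
    ∃ v : ℝ × ℝ → ℂ × ℂ, Continuous v ∧ (∃ C, ∀ z, ‖v z‖ ≤ C) ∧
      ∀ x ξ, v (x, ξ) = (1, 0) + ∫ y in Set.Iic x, scatterField f ξ y (v (y, ξ)) := by
  have hcm := continuous_cumMass hf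
  set W : ℝ := Real.exp (2 * ∫ t, ‖f t‖) with hW
  have hWle : ∀ y, Real.exp (2 * cumMass f y) ≤ W := fun y =>
    Real.exp_le_exp.2 (by linarith [cumMass_le hf y])
  -- The unknown is the solution divided by its weight, so the weighted norm becomes the ordinary
  -- sup norm; `lift` restores the weight.
  let lift : BoundedContinuousFunction (ℝ × ℝ) (ℂ × ℂ) → ℝ × ℝ → ℂ × ℂ :=
    fun w z => Real.exp (2 * cumMass f z.1) • w z
  have hlc : ∀ w, Continuous (lift w) := fun w =>
    (Real.continuous_exp.comp (continuous_const.mul (hcm.comp continuous_fst))).smul w.continuous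
  have hlb : ∀ w z, ‖lift w z‖ ≤ ‖w‖ * Real.exp (2 * cumMass f z.1) := by
    intro w z
    rw [norm_smul, Real.norm_eq_abs, Real.abs_exp, mul_comm]
    exact mul_le_mul_of_nonneg_right (w.norm_coe_le_norm z) (Real.exp_nonneg _)
  have hlb' : ∀ w z, ‖lift w z‖ ≤ ‖w‖ * W := fun w z =>
    (hlb w z).trans (mul_le_mul_of_nonneg_left (hWle _) (norm_nonneg _))
  let S : BoundedContinuousFunction (ℝ × ℝ) (ℂ × ℂ) → ℝ × ℝ → ℂ × ℂ := fun w z =>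
    Real.exp (-(2 * cumMass f z.1)) •
      (((1, 0) : ℂ × ℂ) + ∫ y in Set.Iic z.1, scatterField f z.2 y (lift w (y, z.2)))
  have hSc : ∀ w, Continuous (S w) := fun w =>
    (Real.continuous_exp.comp (continuous_const.mul (hcm.comp continuous_fst)).neg).smul
      (continuous_const.add (continuous_setIntegral_scatterField hf (hlc w) (hlb' w)))
  have hexp : ∀ x, Real.exp (-(2 * cumMass f x)) ≤ 1 := fun x =>
    Real.exp_le_one_iff.2 (by have := cumMass_nonneg f x; linarith)
  have hSb : ∀ w z, ‖S w z‖ ≤ 1 + ‖w‖ / 2 := by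
    intro w z
    have h1 := norm_setIntegral_scatterField_le hf z.2 z.1
      (w := fun y => lift w (y, z.2)) (C := ‖w‖) (fun y => hlb w (y, z.2)) (norm_nonneg _)
    have h2 : ‖((1, 0) : ℂ × ℂ)‖ ≤ 1 := by simp [Prod.norm_def]
    rw [norm_smul, Real.norm_eq_abs, Real.abs_exp]
    calc _ ≤ Real.exp (-(2 * cumMass f z.1)) *
          (1 + ‖w‖ / 2 * Real.exp (2 * cumMass f z.1)) :=
          mul_le_mul_of_nonneg_left ((norm_add_le _ _).trans (add_le_add h2 h1))
            (Real.exp_nonneg _)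
      _ = Real.exp (-(2 * cumMass f z.1)) + ‖w‖ / 2 := by
          rw [mul_add, mul_one, mul_left_comm, ← Real.exp_add, neg_add_cancel, Real.exp_zero,
            mul_one]
      _ ≤ _ := by linarith [hexp z.1]
  let T : BoundedContinuousFunction (ℝ × ℝ) (ℂ × ℂ) → BoundedContinuousFunction (ℝ × ℝ) (ℂ × ℂ) :=
    fun w => BoundedContinuousFunction.ofNormedAddCommGroup (S w) (hSc w) _ (hSb w)
  have hT : ContractingWith (1 / 2) T := by
    refine ⟨by rw [← NNReal.coe_lt_coe]; norm_num, LipschitzWith.of_dist_le_mul fun w w' => ?_⟩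
    rw [BoundedContinuousFunction.dist_le (by positivity)]
    intro z
    have hInt : ∀ u, Integrable fun y => scatterField f z.2 y (lift u (y, z.2)) := fun u =>
      integrable_scatterField hf z.2 ((hlc u).comp (by fun_prop)) fun x => hlb' u (x, z.2)
    have e : S w z - S w' z = Real.exp (-(2 * cumMass f z.1)) •
        ∫ y in Set.Iic z.1, scatterField f z.2 y (lift (w - w') (y, z.2)) := by
      have h1 : ∀ y, scatterField f z.2 y (lift (w - w') (y, z.2)) =
          scatterField f z.2 y (lift w (y, z.2)) - scatterField f z.2 y (lift w' (y, z.2)) := by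
        intro y
        rw [← scatterField_sub]
        simp only [lift, BoundedContinuousFunction.coe_sub, Pi.sub_apply, smul_sub]
      simp only [h1]
      rw [integral_sub (hInt w).integrableOn (hInt w').integrableOn, ← smul_sub,
        add_sub_add_left_eq_sub]
    have h1 := norm_setIntegral_scatterField_le hf z.2 z.1
      (w := fun y => lift (w - w') (y, z.2)) (C := ‖w - w'‖) (fun y => hlb _ (y, z.2))
      (norm_nonneg _)
    change dist (S w z) (S w' z) ≤ _
    rw [dist_eq_norm, e, norm_smul, Real.norm_eq_abs, Real.abs_exp, dist_eq_norm]
    calc _ ≤ Real.exp (-(2 * cumMass f z.1)) *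
          (‖w - w'‖ / 2 * Real.exp (2 * cumMass f z.1)) :=
          mul_le_mul_of_nonneg_left h1 (Real.exp_nonneg _)
      _ = ‖w - w'‖ / 2 := by
          rw [mul_left_comm, ← Real.exp_add, neg_add_cancel, Real.exp_zero, mul_one]
      _ = _ := by push_cast; ring
  have hfix : T (hT.fixedPoint T) = hT.fixedPoint T := hT.fixedPoint_isFixedPt
  refine ⟨lift (hT.fixedPoint T), hlc _, ⟨_, hlb' _⟩, fun x ξ => ?_⟩
  have h1 : S (hT.fixedPoint T) (x, ξ) = hT.fixedPoint T (x, ξ) :=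
    congrArg (fun w : BoundedContinuousFunction (ℝ × ℝ) (ℂ × ℂ) => w (x, ξ)) hfix
  have h2 : lift (hT.fixedPoint T) (x, ξ) =
      Real.exp (2 * cumMass f x) • S (hT.fixedPoint T) (x, ξ) := by rw [h1]
  rw [h2]
  simp only [S]
  rw [smul_smul, ← Real.exp_add, add_neg_cancel, Real.exp_zero, one_smul]

/-- The solution family of the scattering problem for an integrable potential. -/
noncomputable def scatterSol {f : ℝ → ℂ} (hf : Integrable f) : ℝ × ℝ → ℂ × ℂ :=
  (exists_scattering_family hf).choose

theorem continuous_scatterSol {f : ℝ → ℂ} (hf : Integrable f) : Continuous (scatterSol hf) :=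
  (exists_scattering_family hf).choose_spec.1

theorem scatterSol_eq {f : ℝ → ℂ} (hf : Integrable f) (x ξ : ℝ) :
    scatterSol hf (x, ξ) = (1, 0) + ∫ y in Set.Iic x, scatterField f ξ y (scatterSol hf (y, ξ)) :=
  (exists_scattering_family hf).choose_spec.2.2 x ξ

theorem continuous_scatterSol_left {f : ℝ → ℂ} (hf : Integrable f) (ξ : ℝ) :
    Continuous fun x => scatterSol hf (x, ξ) :=
  (continuous_scatterSol hf).comp (by fun_prop)

theorem norm_scatterSol_le {f : ℝ → ℂ} (hf : Integrable f) (x ξ : ℝ) :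
    ‖scatterSol hf (x, ξ)‖ ≤ Real.exp (cumMass f x) := by
  obtain ⟨C, hC⟩ := (exists_scattering_family hf).choose_spec.2.1
  have hcont := continuous_scatterSol_left hf ξ
  have h := le_mul_exp_cumMass hf (g := fun x => ‖scatterSol hf (x, ξ)‖) hcont.norm
    (fun _ => norm_nonneg _) (fun x => hC (x, ξ)) zero_le_one (fun x => ?_) x
  · rwa [one_mul] at h
  · nth_rewrite 1 [scatterSol_eq hf x ξ]
    refine (norm_add_le _ _).trans (add_le_add (by simp [Prod.norm_def]) ?_)
    refine norm_integral_le_of_norm_le (Integrable.integrableOn ?_)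
      (ae_of_all _ fun y => norm_scatterField_le f ξ y _)
    exact hf.norm.mul_bdd (c := C) hcont.norm.aestronglyMeasurable
      (ae_of_all _ fun y => by rw [norm_norm]; exact hC (y, ξ))

theorem norm_scatterSol_le_exp {f : ℝ → ℂ} (hf : Integrable f) (z : ℝ × ℝ) :
    ‖scatterSol hf z‖ ≤ Real.exp (∫ t, ‖f t‖) :=
  (norm_scatterSol_le hf z.1 z.2).trans (Real.exp_le_exp.2 (cumMass_le hf z.1))

theorem integrable_scatterField_scatterSol {f : ℝ → ℂ} (hf : Integrable f) (ξ : ℝ) :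
    Integrable fun y => scatterField f ξ y (scatterSol hf (y, ξ)) :=
  integrable_scatterField hf ξ (continuous_scatterSol_left hf ξ)
    fun x => norm_scatterSol_le_exp hf (x, ξ)

/-- The scattering data of an integrable potential. -/
noncomputable def scatterData {f : ℝ → ℂ} (hf : Integrable f) (ξ : ℝ) : ℂ × ℂ :=
  (1, 0) + ∫ y, scatterField f ξ y (scatterSol hf (y, ξ))

theorem tendsto_scatterSol_atTop {f : ℝ → ℂ} (hf : Integrable f) (ξ : ℝ) :
    Tendsto (fun x => scatterSol hf (x, ξ)) atTop (𝓝 (scatterData hf ξ)) := by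
  refine Tendsto.congr (fun x => (scatterSol_eq hf x ξ).symm) (tendsto_const_nhds.add
    (tendsto_setIntegral_Iic_atTop (integrable_scatterField_scatterSol hf ξ)))

theorem tendsto_scatterSol_atBot {f : ℝ → ℂ} (hf : Integrable f) (ξ : ℝ) :
    Tendsto (fun x => scatterSol hf (x, ξ)) atBot (𝓝 (1, 0)) := by
  have := (tendsto_const_nhds (x := ((1, 0) : ℂ × ℂ))).add
    (tendsto_setIntegral_Iic_atBot fun y => scatterField f ξ y (scatterSol hf (y, ξ)))
  rw [add_zero] at this
  exact this.congr fun x => (scatterSol_eq hf x ξ).symm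

theorem continuous_scatterData {f : ℝ → ℂ} (hf : Integrable f) : Continuous (scatterData hf) := by
  refine continuous_const.add (continuous_of_dominated
    (bound := fun y => ‖f y‖ * Real.exp (∫ t, ‖f t‖)) ?_ ?_ (hf.norm.mul_const _) ?_)
  · exact fun ξ => (integrable_scatterField_scatterSol hf ξ).1
  · exact fun ξ => ae_of_all _ fun y => (norm_scatterField_le f ξ y _).trans
      (mul_le_mul_of_nonneg_left (norm_scatterSol_le_exp hf _) (norm_nonneg _))
  · exact ae_of_all _ fun y => continuous_scatterField_param f y
      ((continuous_scatterSol hf).comp (by fun_prop))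

theorem isScatteringSolution_scatterSol {f : ℝ → ℂ} (hf : Integrable f) (ξ : ℝ) :
    IsScatteringSolution f ξ (fun x => (scatterSol hf (x, ξ)).1)
      (fun x => (scatterSol hf (x, ξ)).2) := by
  have hi := integrable_scatterField_scatterSol hf ξ
  have hAC : ∀ a b, AbsolutelyContinuousOnInterval (fun x => scatterSol hf (x, ξ)) a b := by
    intro a b
    refine (absolutelyContinuousOnInterval_setIntegral_Iic hi a b).of_dist_le fun x _ y _ => ?_
    rw [scatterSol_eq hf x, scatterSol_eq hf y, dist_add_left]
  have hder : ∀ᵐ x, HasDerivAt (fun x => scatterSol hf (x, ξ))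
      (scatterField f ξ x (scatterSol hf (x, ξ))) x := by
    filter_upwards [ae_hasDerivAt_setIntegral_Iic hi] with x hx
    exact (hx.const_add ((1, 0) : ℂ × ℂ)).congr_of_eventuallyEq
      (Eventually.of_forall fun y => scatterSol_eq hf y ξ)
  have hbot := tendsto_scatterSol_atBot hf ξ
  refine ⟨fun a b => (hAC a b).of_dist_le fun x _ y _ => le_max_left _ _,
    fun a b => (hAC a b).of_dist_le fun x _ y _ => le_max_right _ _, ?_, ?_,
    hbot.fst_nhds, hbot.snd_nhds⟩
  · filter_upwards [hder] with x hx
    exact (ContinuousLinearMap.fst ℝ ℂ ℂ).hasFDerivAt.comp_hasDerivAt x hx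
  · filter_upwards [hder] with x hx
    exact (ContinuousLinearMap.snd ℝ ℂ ℂ).hasFDerivAt.comp_hasDerivAt x hx

/-! ### Conservation laws and uniqueness. -/

theorem star_exp_two_pi (x ξ : ℝ) :
    starRingEnd ℂ (Complex.exp (2 * Real.pi * Complex.I * x * ξ)) =
      Complex.exp (-(2 * Real.pi * Complex.I * x * ξ)) := by
  rw [← Complex.exp_conj]
  congr 1
  simp [show starRingEnd ℂ 2 = 2 from map_ofNat _ 2]

theorem star_exp_neg_two_pi (x ξ : ℝ) :
    starRingEnd ℂ (Complex.exp (-(2 * Real.pi * Complex.I * x * ξ))) =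
      Complex.exp (2 * Real.pi * Complex.I * x * ξ) := by
  rw [← Complex.exp_conj]
  congr 1
  simp [show starRingEnd ℂ 2 = 2 from map_ofNat _ 2]

theorem HasDerivAt.complex_conj {g : ℝ → ℂ} {g' : ℂ} {x : ℝ} (hg : HasDerivAt g g' x) :
    HasDerivAt (fun x => starRingEnd ℂ (g x)) (starRingEnd ℂ g') x :=
  Complex.conjCLE.toContinuousLinearMap.hasFDerivAt.comp_hasDerivAt x hg

namespace IsScatteringSolution

variable {f : ℝ → ℂ} {ξ : ℝ} {A B a b : ℝ → ℂ}

/-- The system preserves the indefinite Hermitian form of signature `(1, 1)`, so this pairing of two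
solutions keeps its value at `-∞`. -/
theorem mul_conj_sub_mul_conj (h : IsScatteringSolution f ξ A B)
    (h' : IsScatteringSolution f ξ a b) (x : ℝ) :
    A x * starRingEnd ℂ (a x) - B x * starRingEnd ℂ (b x) = 1 := by
  refine eq_of_absolutelyContinuous_of_deriv_eq_zero
    (g := fun x => A x * starRingEnd ℂ (a x) - B x * starRingEnd ℂ (b x)) (c := 1)
    (fun α β => ((h.absCont_fst α β).cmul (h'.absCont_fst α β).conj).sub
      ((h.absCont_snd α β).cmul (h'.absCont_snd α β).conj)) ?_ ?_ x
  · filter_upwards [h.ode_fst, h.ode_snd, h'.ode_fst, h'.ode_snd] with x h1 h2 h3 h4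
    refine ((h1.mul h3.complex_conj).sub (h2.mul h4.complex_conj)).congr_deriv ?_
    simp only [map_mul, star_exp_two_pi, star_exp_neg_two_pi, Complex.conj_conj]
    ring
  · have h1 := h.init_fst.mul ((Complex.continuous_conj.tendsto _).comp h'.init_fst)
    have h2 := h.init_snd.mul ((Complex.continuous_conj.tendsto _).comp h'.init_snd)
    simpa using h1.sub h2

/-- The coefficient matrix has trace zero, so the Wronskian is constant; equal initial data make it
vanish. -/
theorem mul_sub_mul_eq_zero (h : IsScatteringSolution f ξ A B)
    (h' : IsScatteringSolution f ξ a b) (x : ℝ) : A x * b x - B x * a x = 0 := by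
  refine eq_of_absolutelyContinuous_of_deriv_eq_zero
    (g := fun x => A x * b x - B x * a x) (c := 0)
    (fun α β => ((h.absCont_fst α β).cmul (h'.absCont_snd α β)).sub
      ((h.absCont_snd α β).cmul (h'.absCont_fst α β))) ?_ ?_ x
  · filter_upwards [h.ode_fst, h.ode_snd, h'.ode_fst, h'.ode_snd] with x h1 h2 h3 h4
    exact ((h1.mul h4).sub (h2.mul h3)).congr_deriv (by ring)
  · simpa using (h.init_fst.mul h'.init_snd).sub (h.init_snd.mul h'.init_fst)

theorem norm_sq_eq (h : IsScatteringSolution f ξ A B) (x : ℝ) :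
    ‖A x‖ ^ 2 = 1 + ‖B x‖ ^ 2 := by
  have h1 := h.mul_conj_sub_mul_conj h x
  rw [Complex.mul_conj, Complex.mul_conj, Complex.normSq_eq_norm_sq, Complex.normSq_eq_norm_sq]
    at h1
  have h2 : ‖A x‖ ^ 2 - ‖B x‖ ^ 2 = 1 := by exact_mod_cast h1
  linarith

/-- Uniqueness is purely algebraic: the mixed Hermitian identity, the one for the second solution
alone and the vanishing Wronskian determine the solution. -/
theorem eq_fst (h : IsScatteringSolution f ξ A B) (h' : IsScatteringSolution f ξ a b) (x : ℝ) :
    A x = a x := by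
  linear_combination a x * h.mul_conj_sub_mul_conj h' x - A x * h'.mul_conj_sub_mul_conj h' x
    - starRingEnd ℂ (b x) * h.mul_sub_mul_eq_zero h' x

theorem eq_snd (h : IsScatteringSolution f ξ A B) (h' : IsScatteringSolution f ξ a b) (x : ℝ) :
    B x = b x := by
  linear_combination b x * h.mul_conj_sub_mul_conj h' x - B x * h'.mul_conj_sub_mul_conj h' x
    - starRingEnd ℂ (a x) * h.mul_sub_mul_eq_zero h' x

end IsScatteringSolution

theorem IsNLFTCompact.eq_scatterData {g a b : ℝ → ℂ} (hg : Integrable g)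
    (h : IsNLFTCompact g a b) (ξ : ℝ) : (a ξ, b ξ) = scatterData hg ξ := by
  obtain ⟨A, B, hAB, hA, hB⟩ := h ξ
  have hs := isScatteringSolution_scatterSol hg ξ
  have hlim := tendsto_scatterSol_atTop hg ξ
  refine Prod.ext (tendsto_nhds_unique hA ?_) (tendsto_nhds_unique hB ?_)
  · exact hlim.fst_nhds.congr fun x => (hAB.eq_fst hs x).symm
  · exact hlim.snd_nhds.congr fun x => (hAB.eq_snd hs x).symm

theorem isNLFTCompact_scatterData {g : ℝ → ℂ} (hg : Integrable g) :
    IsNLFTCompact g (fun ξ => (scatterData hg ξ).1) fun ξ => (scatterData hg ξ).2 := fun ξ =>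
  ⟨_, _, isScatteringSolution_scatterSol hg ξ, (tendsto_scatterSol_atTop hg ξ).fst_nhds,
    (tendsto_scatterSol_atTop hg ξ).snd_nhds⟩

theorem norm_sq_scatterData {f : ℝ → ℂ} (hf : Integrable f) (ξ : ℝ) :
    ‖(scatterData hf ξ).1‖ ^ 2 = 1 + ‖(scatterData hf ξ).2‖ ^ 2 := by
  have hlim := tendsto_scatterSol_atTop hf ξ
  refine tendsto_nhds_unique (hlim.fst_nhds.norm.pow 2) ?_
  exact ((hlim.snd_nhds.norm.pow 2).const_add 1).congr fun x =>
    ((isScatteringSolution_scatterSol hf ξ).norm_sq_eq x).symm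

/-! ### Dependence on the potential and the limit over truncations. -/

theorem scatterField_sub_potential (f g : ℝ → ℂ) (ξ x : ℝ) (v w : ℂ × ℂ) :
    scatterField f ξ x v - scatterField g ξ x w =
      scatterField g ξ x (v - w) + scatterField (f - g) ξ x v := by
  ext <;> simp [scatterField] <;> ring

/-- Continuous dependence of the scattering data on the potential. -/
theorem norm_scatterData_sub_le {f g : ℝ → ℂ} (hf : Integrable f) (hg : Integrable g) (ξ : ℝ) :
    ‖scatterData hf ξ - scatterData hg ξ‖ ≤
      ((∫ t, ‖f t - g t‖) * Real.exp (∫ t, ‖f t‖)) * Real.exp (∫ t, ‖g t‖) := by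
  have hcf := continuous_scatterSol_left hf ξ
  have hcg := continuous_scatterSol_left hg ξ
  have hbd : ∀ x, ‖scatterSol hf (x, ξ) - scatterSol hg (x, ξ)‖ ≤
      Real.exp (∫ t, ‖f t‖) + Real.exp (∫ t, ‖g t‖) := fun x =>
    (norm_sub_le _ _).trans (add_le_add (norm_scatterSol_le_exp hf _) (norm_scatterSol_le_exp hg _))
  set c : ℝ := (∫ t, ‖f t - g t‖) * Real.exp (∫ t, ‖f t‖) with hc
  have hc0 : 0 ≤ c := mul_nonneg (integral_nonneg fun _ => norm_nonneg _) (Real.exp_nonneg _)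
  have hsol : ∀ x, ‖scatterSol hf (x, ξ) - scatterSol hg (x, ξ)‖ ≤ c * Real.exp (cumMass g x) := by
    intro x
    refine le_mul_exp_cumMass hg (g := fun x => ‖scatterSol hf (x, ξ) - scatterSol hg (x, ξ)‖)
      (hcf.sub hcg).norm (fun _ => norm_nonneg _) hbd hc0 (fun x => ?_) x
    have i1 := integrable_scatterField_scatterSol hf ξ
    have i2 := integrable_scatterField_scatterSol hg ξ
    have i3 : Integrable fun y =>
        scatterField g ξ y (scatterSol hf (y, ξ) - scatterSol hg (y, ξ)) :=
      integrable_scatterField hg ξ (hcf.sub hcg) hbd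
    have i4 := integrable_scatterField (hf.sub hg) ξ hcf fun x => norm_scatterSol_le_exp hf (x, ξ)
    nth_rewrite 1 [scatterSol_eq hf x, scatterSol_eq hg x]
    rw [add_sub_add_left_eq_sub, ← integral_sub i1.integrableOn i2.integrableOn]
    simp only [scatterField_sub_potential f g]
    rw [integral_add i3.integrableOn i4.integrableOn, add_comm]
    refine (norm_add_le _ _).trans (add_le_add ?_ ?_)
    · have h1 : ∀ y, ‖scatterField (f - g) ξ y (scatterSol hf (y, ξ))‖ ≤
          ‖f y - g y‖ * Real.exp (∫ t, ‖f t‖) := fun y =>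
        (norm_scatterField_le _ ξ y _).trans
          (mul_le_mul_of_nonneg_left (norm_scatterSol_le_exp hf _) (norm_nonneg _))
      refine (norm_integral_le_of_norm_le ((hf.sub hg).norm.mul_const _).integrableOn
        (ae_of_all _ h1)).trans ?_
      rw [hc, ← integral_mul_const]
      exact setIntegral_le_integral ((hf.sub hg).norm.mul_const _)
        (ae_of_all _ fun y => mul_nonneg (norm_nonneg _) (Real.exp_nonneg _))
    · refine norm_integral_le_of_norm_le (Integrable.integrableOn ?_)
        (ae_of_all _ fun y => norm_scatterField_le g ξ y _)
      exact hg.norm.mul_bdd (hcf.sub hcg).norm.aestronglyMeasurable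
        (ae_of_all _ fun y => by rw [norm_norm]; exact hbd y)
  refine le_of_tendsto ((tendsto_scatterSol_atTop hf ξ).sub (tendsto_scatterSol_atTop hg ξ)).norm
    (Eventually.of_forall fun x => (hsol x).trans ?_)
  exact mul_le_mul_of_nonneg_left (Real.exp_le_exp.2 (cumMass_le hg x)) hc0

theorem tendsto_scatterData_truncation {f : ℝ → ℂ} (hf : Integrable f) (ξ : ℝ) :
    Tendsto (fun R : ℝ => scatterData (hf.indicator (measurableSet_Icc (a := -R) (b := R))) ξ)
      atTop (𝓝 (scatterData hf ξ)) := by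
  have hL1 : Tendsto (fun R : ℝ => ∫ t, ‖f t - (Set.Icc (-R) R).indicator f t‖) atTop (𝓝 0) := by
    have h := tendsto_integral_filter_of_dominated_convergence (μ := volume) (l := atTop)
      (F := fun (R : ℝ) t => ‖f t - (Set.Icc (-R) R).indicator f t‖) (f := fun _ => (0 : ℝ))
      (fun t => ‖f t‖) ?_ ?_ hf.norm ?_
    · simpa using h
    · exact Eventually.of_forall fun R => (hf.1.sub (hf.1.indicator measurableSet_Icc)).norm
    · refine Eventually.of_forall fun R => ae_of_all _ fun t => ?_
      rw [norm_norm]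
      by_cases ht : t ∈ Set.Icc (-R) R
      · rw [Set.indicator_of_mem ht, sub_self, norm_zero]; exact norm_nonneg _
      · rw [Set.indicator_of_notMem ht, sub_zero]
    · refine ae_of_all _ fun t => tendsto_const_nhds.congr' ?_
      filter_upwards [eventually_ge_atTop |t|] with R hR
      rw [Set.indicator_of_mem (Set.mem_Icc.2 (abs_le.1 hR)), sub_self, norm_zero]
  rw [tendsto_iff_norm_sub_tendsto_zero]
  have hz := (hL1.mul_const (Real.exp (∫ t, ‖f t‖))).mul_const (Real.exp (∫ t, ‖f t‖))
  rw [zero_mul, zero_mul] at hz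
  refine squeeze_zero (fun _ => norm_nonneg _) (fun R => ?_) hz
  rw [norm_sub_rev]
  refine (norm_scatterData_sub_le hf _ ξ).trans (mul_le_mul_of_nonneg_left
    (Real.exp_le_exp.2 ?_) (by positivity))
  exact integral_mono (hf.indicator measurableSet_Icc).norm hf.norm
    fun t => norm_indicator_le_norm_self _ _

theorem isNLFT_scatterData {f : ℝ → ℂ} (hf : Integrable f) :
    IsNLFT f (fun ξ => (scatterData hf ξ).1) fun ξ => (scatterData hf ξ).2 :=
  ⟨fun R ξ => (scatterData (hf.indicator (measurableSet_Icc (a := -R) (b := R))) ξ).1,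
    fun R ξ => (scatterData (hf.indicator (measurableSet_Icc (a := -R) (b := R))) ξ).2,
    fun _ _ => isNLFTCompact_scatterData _,
    fun ξ => ⟨(tendsto_scatterData_truncation hf ξ).fst_nhds,
      (tendsto_scatterData_truncation hf ξ).snd_nhds⟩⟩

theorem IsNLFT.eq_scatterData {f a b : ℝ → ℂ} (hf : Integrable f) (h : IsNLFT f a b) (ξ : ℝ) :
    (a ξ, b ξ) = scatterData hf ξ := by
  obtain ⟨aR, bR, hR, hlim⟩ := h
  refine tendsto_nhds_unique ((hlim ξ).1.prodMk_nhds (hlim ξ).2) ?_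
  refine (tendsto_scatterData_truncation hf ξ).congr' ?_
  filter_upwards [eventually_gt_atTop 0] with R hR0
  exact ((hR R hR0).eq_scatterData (hf.indicator measurableSet_Icc) ξ).symm

/-! ### The `L^q` bound for the second coefficient. -/

theorem lineFourier_indicator_Ici {f : ℝ → ℂ} (hf : Integrable f) (t ξ : ℝ) :
    lineFourier ((Set.Ici t).indicator f) ξ = lineFourier f ξ -
      ∫ y in Set.Iic t, f y * Complex.exp (-(2 * Real.pi * Complex.I * y * ξ)) := by
  have hi := integrable_mul_exp_neg_two_pi hf ξ
  have h1 : lineFourier ((Set.Ici t).indicator f) ξ =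
      ∫ y in Set.Ici t, f y * Complex.exp (-(2 * Real.pi * Complex.I * y * ξ)) := by
    rw [lineFourier, ← integral_indicator measurableSet_Ici]
    congr 1
    ext y
    by_cases hy : y ∈ Set.Ici t
    · rw [Set.indicator_of_mem hy, Set.indicator_of_mem hy]
    · rw [Set.indicator_of_notMem hy, Set.indicator_of_notMem hy, zero_mul]
  rw [h1, integral_Ici_eq_integral_Ioi, lineFourier,
    ← intervalIntegral.integral_Iic_add_Ioi hi.integrableOn hi.integrableOn (b := t),
    add_sub_cancel_left]

theorem continuous_lineFourier_indicator_Ici {f : ℝ → ℂ} (hf : Integrable f) :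
    Continuous fun z : ℝ × ℝ => lineFourier ((Set.Ici z.1).indicator f) z.2 := by
  simp only [lineFourier_indicator_Ici hf]
  refine ((continuous_lineFourier hf).comp continuous_snd).sub ?_
  exact continuous_setIntegral_Iic_param
    (H := fun y ξ => f y * Complex.exp (-(2 * Real.pi * Complex.I * y * ξ))) hf.norm
    (fun ξ => (integrable_mul_exp_neg_two_pi hf ξ).1)
    (fun y ξ => by rw [norm_mul, norm_exp_neg_two_pi, mul_one]) fun y => by fun_prop

/-- The second scattering coefficient as a linear Fourier transform plus a superposition of Fourier
transforms of truncations of the potential. -/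
theorem scatterData_snd_eq {f : ℝ → ℂ} (hf : Integrable f) (ξ : ℝ) :
    (scatterData hf ξ).2 = lineFourier f ξ +
      ∫ t, (scatterField f ξ t (scatterSol hf (t, ξ))).1 *
        lineFourier ((Set.Ici t).indicator f) ξ := by
  have hi := integrable_scatterField_scatterSol hf ξ
  have hk := integrable_mul_exp_neg_two_pi hf ξ
  set k : ℝ → ℂ := fun y => f y * Complex.exp (-(2 * Real.pi * Complex.I * y * ξ)) with hkdef
  set l : ℝ → ℂ := fun t => (scatterField f ξ t (scatterSol hf (t, ξ))).1 with hldef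
  have hl : Integrable l := hi.fst
  have hfst : ∀ y, (scatterSol hf (y, ξ)).1 = 1 + ∫ t in Set.Iic y, l t := by
    intro y
    rw [scatterSol_eq hf y ξ, Prod.fst_add, fst_integral hi.integrableOn]
  -- Fubini on the triangle `t ≤ y`: for fixed `y` the inner integral is `a(y) - 1`, while for fixed
  -- `t` it is `a'(t)` times the transform of `f` cut off to `[t, ∞)`.
  have hP : Integrable (Set.indicator {z : ℝ × ℝ | z.2 ≤ z.1} fun z => k z.1 * l z.2)
      (volume.prod volume) :=
    (hk.mul_prod hl).indicator (measurableSet_le measurable_snd measurable_fst)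
  have hy : ∀ y, ∫ t, Set.indicator {z : ℝ × ℝ | z.2 ≤ z.1} (fun z => k z.1 * l z.2) (y, t) =
      k y * ∫ t in Set.Iic y, l t := by
    intro y
    rw [← integral_indicator measurableSet_Iic, ← integral_const_mul]
    congr 1
    ext t
    by_cases ht : t ≤ y
    · rw [Set.indicator_of_mem (show (y, t) ∈ {z : ℝ × ℝ | z.2 ≤ z.1} from ht),
        Set.indicator_of_mem (Set.mem_Iic.2 ht)]
    · rw [Set.indicator_of_notMem (show (y, t) ∉ {z : ℝ × ℝ | z.2 ≤ z.1} from ht),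
        Set.indicator_of_notMem (show t ∉ Set.Iic y from ht), mul_zero]
  have ht : ∀ t, ∫ y, Set.indicator {z : ℝ × ℝ | z.2 ≤ z.1} (fun z => k z.1 * l z.2) (y, t) =
      l t * lineFourier ((Set.Ici t).indicator f) ξ := by
    intro t
    rw [lineFourier, ← integral_const_mul]
    congr 1
    ext y
    by_cases ht : t ≤ y
    · rw [Set.indicator_of_mem (show (y, t) ∈ {z : ℝ × ℝ | z.2 ≤ z.1} from ht),
        Set.indicator_of_mem (Set.mem_Ici.2 ht), mul_comm]
    · rw [Set.indicator_of_notMem (show (y, t) ∉ {z : ℝ × ℝ | z.2 ≤ z.1} from ht),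
        Set.indicator_of_notMem (show y ∉ Set.Ici t from ht), zero_mul, mul_zero]
  have hP1 : Integrable fun y => k y * ∫ t in Set.Iic y, l t := by
    have := hP.integral_prod_left
    simpa only [hy] using this
  calc (scatterData hf ξ).2 = ∫ y, k y * (scatterSol hf (y, ξ)).1 := by
        rw [scatterData, Prod.snd_add, snd_integral hi, zero_add]
        rfl
    _ = ∫ y, (k y + k y * ∫ t in Set.Iic y, l t) := by
        congr 1
        ext y
        rw [hfst]
        ring
    _ = lineFourier f ξ + ∫ y, k y * ∫ t in Set.Iic y, l t := integral_add hk hP1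
    _ = _ := by
        congr 1
        simp only [← hy]
        exact (integral_integral_swap (f := fun y t =>
          Set.indicator {z : ℝ × ℝ | z.2 ≤ z.1} (fun z => k z.1 * l z.2) (y, t)) hP).trans
          (integral_congr_ae (ae_of_all _ ht))

/-- An integral Minkowski inequality for a family with a uniform `L^q` bound. -/
theorem eLpNorm_lintegral_le {ρ : Measure ℝ} [IsFiniteMeasure ρ] {G : ℝ × ℝ → ℂ}
    (hG : Continuous G) {q : ℝ} (hq : 1 ≤ q) {N : ENNReal}
    (hN : ∀ t, eLpNorm (fun ξ => G (t, ξ)) (ENNReal.ofReal q) volume ≤ N) :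
    (∫⁻ ξ, (∫⁻ t, ‖G (t, ξ)‖ₑ ∂ρ) ^ q) ^ (1 / q) ≤ ρ Set.univ * N := by
  have hq0 : 0 < q := by linarith
  -- As the bound `N` is uniform in `t`, Hölder for the finite measure `ρ` followed by Tonelli
  -- suffices: the masses multiply to `ρ(univ)^(q-1) · ρ(univ)`.
  have hJ : ∀ ξ, (∫⁻ t, ‖G (t, ξ)‖ₑ ∂ρ) ^ q ≤
      (∫⁻ t, ‖G (t, ξ)‖ₑ ^ q ∂ρ) * ρ Set.univ ^ (q - 1) := by
    intro ξ
    have hc : Continuous fun t => G (t, ξ) := hG.comp (by fun_prop)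
    have h := eLpNorm_le_eLpNorm_mul_rpow_measure_univ (p := 1) (q := ENNReal.ofReal q) (μ := ρ)
      (by rw [← ENNReal.ofReal_one]; exact ENNReal.ofReal_le_ofReal hq) hc.aestronglyMeasurable
    rw [eLpNorm_one_eq_lintegral_enorm, eLpNorm_eq_lintegral_rpow_enorm_toReal
      (by simpa using hq0) ENNReal.ofReal_ne_top, ENNReal.toReal_ofReal hq0.le,
      ENNReal.toReal_one] at h
    refine (ENNReal.rpow_le_rpow h hq0.le).trans (le_of_eq ?_)
    rw [ENNReal.mul_rpow_of_nonneg _ _ hq0.le, ← ENNReal.rpow_mul, ← ENNReal.rpow_mul,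
      show 1 / q * q = 1 by field_simp, ENNReal.rpow_one]
    congr 2
    field_simp
  have hN' : ∀ t, ∫⁻ ξ, ‖G (t, ξ)‖ₑ ^ q ≤ N ^ q := by
    intro t
    have h := ENNReal.rpow_le_rpow (hN t) hq0.le
    rwa [eLpNorm_eq_lintegral_rpow_enorm_toReal (by simpa using hq0) ENNReal.ofReal_ne_top,
      ENNReal.toReal_ofReal hq0.le, ← ENNReal.rpow_mul, show 1 / q * q = 1 by field_simp,
      ENNReal.rpow_one] at h
  have hmeas : Measurable fun z : ℝ × ℝ => ‖G z‖ₑ ^ q := hG.measurable.enorm.pow_const q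
  have h1 : ∫⁻ ξ, (∫⁻ t, ‖G (t, ξ)‖ₑ ∂ρ) ^ q ≤ (ρ Set.univ * N) ^ q := by
    calc _ ≤ ∫⁻ ξ, (∫⁻ t, ‖G (t, ξ)‖ₑ ^ q ∂ρ) * ρ Set.univ ^ (q - 1) := lintegral_mono hJ
      _ = (∫⁻ ξ, ∫⁻ t, ‖G (t, ξ)‖ₑ ^ q ∂ρ) * ρ Set.univ ^ (q - 1) :=
          lintegral_mul_const' _ _
            (ENNReal.rpow_ne_top_of_nonneg (by linarith) (measure_ne_top ρ _))
      _ = (∫⁻ t, ∫⁻ ξ, ‖G (t, ξ)‖ₑ ^ q ∂volume ∂ρ) * ρ Set.univ ^ (q - 1) := by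
          rw [lintegral_lintegral_swap (f := fun t ξ => ‖G (t, ξ)‖ₑ ^ q) hmeas.aemeasurable]
      _ ≤ (N ^ q * ρ Set.univ) * ρ Set.univ ^ (q - 1) := by
          refine mul_le_mul' ((lintegral_mono hN').trans (le_of_eq ?_)) le_rfl
          rw [lintegral_const]
      _ = (ρ Set.univ * N) ^ q := by
          rw [ENNReal.mul_rpow_of_nonneg _ _ hq0.le, mul_comm (N ^ q), mul_right_comm]
          congr 1
          nth_rewrite 1 [← ENNReal.rpow_one (ρ Set.univ)]
          rw [← ENNReal.rpow_add_of_nonneg _ _ zero_le_one (by linarith), add_sub_cancel]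
  refine (ENNReal.rpow_le_rpow h1 (by positivity)).trans (le_of_eq ?_)
  rw [← ENNReal.rpow_mul, show q * (1 / q) = 1 by field_simp, ENNReal.rpow_one]

/-- The linear term contributes `N` and the superposition at most its mass `e^{‖f‖₁} - 1` times `N`,
which add up to `e^{‖f‖₁} N`. -/
theorem eLpNorm_scatterData_snd_le {p : ℝ} (hp1 : 1 < p) (hp2 : p < 2) {f : ℝ → ℂ}
    (hf : Integrable f) :
    eLpNorm (fun ξ => (scatterData hf ξ).2) (ENNReal.ofReal (p / (p - 1))) volume ≤
      ENNReal.ofReal (becknerConst p * Real.exp (∫ x, ‖f x‖)) *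
        eLpNorm f (ENNReal.ofReal p) volume := by
  have hp0 : 0 < p - 1 := by linarith
  obtain ⟨q, hq⟩ : ∃ q, q = p / (p - 1) := ⟨_, rfl⟩
  have hq1 : 1 ≤ q := by rw [hq, le_div_iff₀ hp0]; linarith
  have hq0 : 0 < q := by linarith
  rw [← hq]
  set N : ENNReal := ENNReal.ofReal (becknerConst p) * eLpNorm f (ENNReal.ofReal p) volume
  -- A majorant of `|a'(t)|` independent of `ξ`, so that it can serve as the density of a single
  -- measure for all frequencies.
  set w : ℝ → ℝ := fun t => ‖f t‖ * Real.exp (cumMass f t) with hw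
  have hwi : Integrable w := by
    simpa only [one_mul] using integrable_norm_mul_exp_cumMass hf 1
  have hw0 : ∀ t, 0 ≤ w t := fun t => by positivity
  have hwm : AEMeasurable (fun t => ENNReal.ofReal (w t)) volume :=
    hwi.1.aemeasurable.ennreal_ofReal
  have hmass : ∫⁻ t, ENNReal.ofReal (w t) = ENNReal.ofReal (Real.exp (∫ x, ‖f x‖) - 1) := by
    rw [← ofReal_integral_eq_lintegral_ofReal hwi (ae_of_all _ hw0),
      integral_norm_mul_exp_cumMass hf]
  set ρ : Measure ℝ := volume.withDensity fun t => ENNReal.ofReal (w t) with hρ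
  have hρu : ρ Set.univ = ENNReal.ofReal (Real.exp (∫ x, ‖f x‖) - 1) := by
    rw [hρ, withDensity_apply _ MeasurableSet.univ, setLIntegral_univ, hmass]
  have : IsFiniteMeasure ρ := ⟨by rw [hρu]; exact ENNReal.ofReal_lt_top⟩
  set G : ℝ × ℝ → ℂ := fun z => lineFourier ((Set.Ici z.1).indicator f) z.2 with hG
  have hGc : Continuous G := continuous_lineFourier_indicator_Ici hf
  have hGN : ∀ t, eLpNorm (fun ξ => G (t, ξ)) (ENNReal.ofReal q) volume ≤ N := by
    intro t
    have h := sharpHausdorffYoung hp1 hp2 (hf.indicator (measurableSet_Ici (a := t)))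
    rw [SharpHausdorffYoung, ← hq] at h
    exact h.trans (mul_le_mul' le_rfl (eLpNorm_indicator_le f))
  set D : ℝ → ℂ := fun ξ => ∫ t, (scatterField f ξ t (scatterSol hf (t, ξ))).1 * G (t, ξ) with hD
  have hdec : (fun ξ => (scatterData hf ξ).2) = lineFourier f + D := by
    ext ξ
    exact scatterData_snd_eq hf ξ
  have hDc : Continuous D := by
    have : D = (fun ξ => (scatterData hf ξ).2) - lineFourier f := by rw [hdec, add_sub_cancel_left]
    rw [this]
    exact (continuous_snd.comp (continuous_scatterData hf)).sub (continuous_lineFourier hf)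
  have hDle : ∀ ξ, ‖D ξ‖ₑ ≤ ∫⁻ t, ‖G (t, ξ)‖ₑ ∂ρ := by
    intro ξ
    have hGm : Measurable fun t => ‖G (t, ξ)‖ₑ :=
      (hGc.comp (by fun_prop : Continuous fun t : ℝ => (t, ξ))).measurable.enorm
    rw [hρ, lintegral_withDensity_eq_lintegral_mul₀ hwm hGm.aemeasurable]
    refine (enorm_integral_le_lintegral_enorm _).trans (lintegral_mono fun t => ?_)
    rw [enorm_mul, Pi.mul_apply]
    refine mul_le_mul' ?_ le_rfl
    rw [← ofReal_norm]
    refine ENNReal.ofReal_le_ofReal (((norm_fst_le _).trans (norm_scatterField_le f ξ t _)).trans ?_)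
    exact mul_le_mul_of_nonneg_left (norm_scatterSol_le hf t ξ) (norm_nonneg _)
  have hDN : eLpNorm D (ENNReal.ofReal q) volume ≤ ρ Set.univ * N := by
    rw [eLpNorm_eq_lintegral_rpow_enorm_toReal (by simpa using hq0) ENNReal.ofReal_ne_top,
      ENNReal.toReal_ofReal hq0.le]
    refine le_trans (ENNReal.rpow_le_rpow (lintegral_mono fun ξ =>
      ENNReal.rpow_le_rpow (hDle ξ) hq0.le) (by positivity)) (eLpNorm_lintegral_le hGc hq1 hGN)
  have hlin : eLpNorm (lineFourier f) (ENNReal.ofReal q) volume ≤ N := by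
    have h := sharpHausdorffYoung hp1 hp2 hf
    rwa [SharpHausdorffYoung, ← hq] at h
  rw [hdec]
  calc _ ≤ eLpNorm (lineFourier f) (ENNReal.ofReal q) volume +
        eLpNorm D (ENNReal.ofReal q) volume :=
        eLpNorm_add_le (continuous_lineFourier hf).aestronglyMeasurable hDc.aestronglyMeasurable
          (by rw [← ENNReal.ofReal_one]; exact ENNReal.ofReal_le_ofReal hq1)
    _ ≤ N + ρ Set.univ * N := add_le_add hlin hDN
    _ = ENNReal.ofReal (Real.exp (∫ x, ‖f x‖)) * N := by
        have hE : 1 ≤ Real.exp (∫ x, ‖f x‖) :=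
          Real.one_le_exp (integral_nonneg fun _ => norm_nonneg _)
        nth_rewrite 1 [← one_mul N]
        rw [← add_mul, hρu, ← ENNReal.ofReal_one, ← ENNReal.ofReal_add zero_le_one (by linarith),
          add_sub_cancel]
    _ = _ := by
        rw [mul_comm (becknerConst p), ENNReal.ofReal_mul (Real.exp_nonneg _), mul_assoc]

theorem mainTheorem2 (p q : ℝ) (hp1 : 1 < p) (hp2 : p < 2) (hq : q = p / (p - 1))
    (f : ℝ → ℂ) (hf : Integrable f volume) :
    (∃! ab : (ℝ → ℂ) × (ℝ → ℂ), IsNLFT f ab.1 ab.2) ∧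
    ∀ a b : ℝ → ℂ, IsNLFT f a b →
      (∀ ξ : ℝ, 1 ≤ ‖a ξ‖) ∧
      AEStronglyMeasurable (fun ξ : ℝ => Real.sqrt (Real.log (‖a ξ‖ ^ 2))) volume ∧
      eLpNorm (fun ξ : ℝ => Real.sqrt (Real.log (‖a ξ‖ ^ 2))) (ENNReal.ofReal q) volume
        ≤ ENNReal.ofReal (becknerConst p * Real.exp (∫ x, ‖f x‖))
          * eLpNorm f (ENNReal.ofReal p) volume := by
  refine ⟨⟨(fun ξ => (scatterData hf ξ).1, fun ξ => (scatterData hf ξ).2),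
    isNLFT_scatterData hf, ?_⟩, ?_⟩
  · rintro ⟨a, b⟩ hab
    have h := IsNLFT.eq_scatterData hf hab
    exact Prod.ext (funext fun ξ => congrArg Prod.fst (h ξ))
      (funext fun ξ => congrArg Prod.snd (h ξ))
  · intro a b hab
    have h := hab.eq_scatterData hf
    have ha : a = fun ξ => (scatterData hf ξ).1 := funext fun ξ => congrArg Prod.fst (h ξ)
    have hsq : ∀ ξ, ‖a ξ‖ ^ 2 = 1 + ‖(scatterData hf ξ).2‖ ^ 2 := fun ξ => by
      rw [ha]; exact norm_sq_scatterData hf ξ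
    have hac : Continuous a := by rw [ha]; exact continuous_fst.comp (continuous_scatterData hf)
    refine ⟨fun ξ => ?_, ?_, ?_⟩
    · have h1 := hsq ξ
      nlinarith [norm_nonneg (a ξ), sq_nonneg ‖(scatterData hf ξ).2‖]
    · exact (((hac.norm.measurable.pow_const 2).log).sqrt).aestronglyMeasurable
    · refine le_trans (eLpNorm_mono fun ξ => ?_)
        (hq ▸ eLpNorm_scatterData_snd_le hp1 hp2 hf)
      rw [Real.norm_of_nonneg (Real.sqrt_nonneg _)]
      refine Real.sqrt_le_iff.2 ⟨norm_nonneg _, ?_⟩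
      -- `log |a|² ≤ |a|² - 1 = |b|²`, so the bound on `b` transfers pointwise.
      have h2 := Real.log_le_sub_one_of_pos (x := ‖a ξ‖ ^ 2) (by rw [hsq]; positivity)
      rw [hsq] at h2 ⊢
      linarith
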